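/- Let $G$ be a locally compact (Hausdorff) group with left Haar measure that is an IN group, i.e. there is a compact neighbourhood $Q_0$ of the identity with $xQ_0=Q_0x$ for all $x\in G$. Let $\pi$ be an irreducible (strongly continuous) unitary representation of $G$ on a Hilbert space $\mathcal H$, and put $V_gf(x)=\langle f,\pi(x)g\rangle$ for $f,g\in\mathcal H$. Let $w$ be a continuous positive weight on $G$ with $w(xy)\le w(x)w(y)$ and $w(x^{-1})=w(x)$ for all $x,y\in G$, and let $0<p\le 1$. Fix a relatively compact measurable neighbourhood $Q$ of the identity. For $F\in L^\infty_{loc}(G)$ put $K(F)(x)=\|\chi_{xQ}F\|_\infty$, and for a weight $m$ let $W(L^\infty,L^p_m)$ be the space of all such $F$ with $\|F|W(L^\infty,L^p_m)\|:=\|K(F)\,m\|_{L^p}<\infty$. Call $g\in\mathcal H$ admissible if $V_gg\in L^2(G)$, and let $\mathbb B^p_m$ be the set of admissible $g$ with $V_gg\in W(L^\infty,L^p_m)$. Let $L_xF(y)=F(x^{-1}y)$, $R_xF(y)=F(yx)$, let $\Delta$ be the Haar module, and define, with operator quasi-norms on $W(L^\infty,L^p_w)$, $$w'(x)=\max\{\|R_x\|,\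 \Delta(x^{-1})\|R_{x^{-1}}\|\},\qquad v(x)=\max\{1,\|L_{x^{-1}}\|\}.$$ Let $\mathbb A_v=\{g\in\mathcal H: V_gg\in L^1_v\}$ and $\mathbb B(L^p_w)=\mathbb B^p_{w'}\cap\mathbb A_v$. For $g_1\in\mathbb A_v\setminus\{0\}$ let $\mathcal H^1_v=\{h\in\mathcal H: V_{g_1}h\in L^1_v\}$, with norm $\|V_{g_1}h\|_{L^1_v}$, and let $(\mathcal H^1_v)^\urcorner$ be the space of its bounded conjugate-linear functionals. For $g_0\in\mathbb B(L^p_w)\setminus\{0\}$ let $$\mathcal C(L^p_w)=\{\varphi\in(\mathcal H^1_v)^\urcorner:\ \big(x\mapsto\varphi(\pi(x)g_0)\big)\in W(L^\infty,L^p_w)\}.$$ Theorem. If $f,g\in\mathcal H\setminus\{0\}$ and $V_gf\in W(L^\infty,L^p_w)$, then both $f$ and $g$ lie in $\mathbb B^p_w$. Moreover $\mathbb B(L^p_w)\neq\{0\}$ and $\mathbb B^p_w=\mathcal C(L^p_w)$; that is, for all $g_1\in\mathbb A_v\setminus\{0\}$ and $g_0\in\mathbb B(L^p_w)\setminus\{0\}$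 one has $\pi(x)g_0\in\mathcal H^1_v$ for all $x\in G$, and the map $f\mapsto\langle f,\cdot\rangle$ is a bijection of $\mathbb B^p_w$ onto $\mathcal C(L^p_w)$. -/

import Mathlib

open MeasureTheory Topology
open scoped ENNReal NNReal Pointwise

noncomputable section

namespace Coorbit

/-- `G` is an IN group: there is a compact neighbourhood `Q` of the identity with `xQ = Qx`
for all `x`. -/
def IsINGroup (G : Type*) [Group G] [TopologicalSpace G] : Prop :=
  ∃ Q : Set G, IsCompact Q ∧ Q ∈ 𝓝 (1 : G) ∧
    ∀ x : G, (fun q => x * q) '' Q = (fun q => q * x) '' Q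

/-- A (measurable) relatively compact neighbourhood of the identity. -/
structure IsWindow {G : Type*} [Group G] [TopologicalSpace G] [MeasurableSpace G]
    (Q : Set G) : Prop where
  mem_nhds : Q ∈ 𝓝 (1 : G)
  isCompact_closure : IsCompact (closure Q)
  measurableSet : MeasurableSet Q

/-- A submultiplicative weight: a continuous positive function with `w (x y) ≤ w x * w y`. -/
structure IsSubmultiplicativeWeight {G : Type*} [Group G] [TopologicalSpace G]
    (w : G → ℝ) : Prop where
  continuous : Continuous w
  pos : ∀ x, 0 < w x
  mul_le : ∀ x y, w (x * y) ≤ w x * w y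

section Functions

variable {G : Type*} [Group G] [TopologicalSpace G] [MeasurableSpace G]

/-- Left translation `L_x F (y) = F (x⁻¹ y)`. -/
def leftTranslate (x : G) (F : G → ℂ) : G → ℂ := fun y => F (x⁻¹ * y)

/-- Right translation `R_x F (y) = F (y x)`. -/
def rightTranslate (x : G) (F : G → ℂ) : G → ℂ := fun y => F (y * x)

/-- The control function `K(F, Q, L^∞)(x) = ‖(L_x χ_Q) F‖_∞ = ‖χ_{xQ} F‖_∞`. -/
def control (μ : Measure G) (Q : Set G) (F : G → ℂ) (x : G) : ℝ≥0∞ :=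
  eLpNorm ((x • Q).indicator F) ∞ μ

/-- The quasi-norm `‖K(F, Q, L^∞) | L^p_m‖ = (∫ (K(F, Q, L^∞) m)^p)^{1/p}`
of `W(L^∞, L^p_m, Q)`, where `0 < p < ∞` and `m` is a weight with values in `[0, ∞]`. -/
def wienerNorm (μ : Measure G) (Q : Set G) (p : ℝ) (m : G → ℝ≥0∞) (F : G → ℂ) : ℝ≥0∞ :=
  (∫⁻ x, (control μ Q F x * m x) ^ p ∂μ) ^ (1 / p)

/-- `F ∈ W(L^∞, L^p_m, Q)`: `F` is measurable, belongs locally to `L^∞`, and its control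
function belongs to `L^p_m`. (For a left Haar measure the control function of such an `F` is lower
semicontinuous, so that its measurability need not be demanded.) -/
structure MemWiener (μ : Measure G) (Q : Set G) (p : ℝ) (m : G → ℝ≥0∞) (F : G → ℂ) : Prop where
  aestronglyMeasurable : AEStronglyMeasurable F μ
  locallyBounded : ∀ C : Set G, IsCompact C → eLpNorm (C.indicator F) ∞ μ < ∞
  norm_lt_top : wienerNorm μ Q p m F < ∞

/-- The operator quasi-norm of `T` on `W(L^∞, L^p_m, Q)`. -/
def wienerOpNorm (μ : Measure G) (Q : Set G) (p : ℝ) (m : G → ℝ≥0∞)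
    (T : (G → ℂ) → (G → ℂ)) : ℝ≥0∞ :=
  sInf {C : ℝ≥0∞ | ∀ F, MemWiener μ Q p m F → wienerNorm μ Q p m (T F) ≤ C * wienerNorm μ Q p m F}

/-- A real weight as a function with values in `[0, ∞]`. -/
def toWeight (w : G → ℝ) : G → ℝ≥0∞ := fun x => ENNReal.ofReal (w x)

/-- The weight `max {1, ‖L_{x⁻¹}‖}`, with the operator quasi-norm taken on `W(L^∞, L^p_w, Q)`. -/
def leftWeight (μ : Measure G) (Q : Set G) (p : ℝ) (w : G → ℝ) (x : G) : ℝ≥0∞ :=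
  max 1 (wienerOpNorm μ Q p (toWeight w) (leftTranslate x⁻¹))

variable [IsTopologicalGroup G] [LocallyCompactSpace G]

/-- The Haar module `Δ`, with the convention `∫ F (y x) dy = Δ(x⁻¹) ∫ F (y) dy` for the left Haar
measure; Mathlib's `modularCharacter` is `x ↦ Δ(x⁻¹)`. -/
def haarModule (x : G) : ℝ≥0 := Measure.modularCharacter x⁻¹

/-- The weight `max {‖R_x‖, Δ(x⁻¹) ‖R_{x⁻¹}‖}`, with operator quasi-norms taken on
`W(L^∞, L^p_w, Q)`. -/
def rightWeight (μ : Measure G) (Q : Set G) (p : ℝ) (w : G → ℝ) (x : G) : ℝ≥0∞ :=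
  max (wienerOpNorm μ Q p (toWeight w) (rightTranslate x))
    ((haarModule x⁻¹ : ℝ≥0∞) * wienerOpNorm μ Q p (toWeight w) (rightTranslate x⁻¹))

end Functions

section Representation

variable {G : Type*} [Group G] [TopologicalSpace G] [MeasurableSpace G]
variable {H : Type*} [NormedAddCommGroup H] [InnerProductSpace ℂ H] [CompleteSpace H]

/-- An irreducible (strongly continuous) unitary representation on a Hilbert space `H ≠ 0`. -/
structure IsIrreducibleUnitaryRep (π : G →* unitary (H →L[ℂ] H)) : Prop where
  continuous : ∀ h : H, Continuous fun x : G => (π x : H →L[ℂ] H) h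
  nontrivial : Nontrivial H
  irreducible : ∀ S : Submodule ℂ H, IsClosed (S : Set H) →
    (∀ x : G, ∀ h ∈ S, (π x : H →L[ℂ] H) h ∈ S) → S = ⊥ ∨ S = ⊤

/-- The voice transform `V_g f (x) = ⟨f, π(x) g⟩`; the inner product of the text is linear in the
first argument, Mathlib's in the second. -/
def voice (π : G →* unitary (H →L[ℂ] H)) (g f : H) (x : G) : ℂ :=
  inner ℂ ((π x : H →L[ℂ] H) g) f

/-- The norm `‖V_g f | L^1_v‖ = ∫ |V_g f| v`. -/
def voiceL1Norm (μ : Measure G) (π : G →* unitary (H →L[ℂ] H)) (v : G → ℝ≥0∞) (g f : H) : ℝ≥0∞ :=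
  ∫⁻ x, ‖voice π g f x‖ₑ * v x ∂μ

/-- The class `𝔸_v = {g ∈ H : V_g g ∈ L^1_v}`. -/
def analyzingA (μ : Measure G) (π : G →* unitary (H →L[ℂ] H)) (v : G → ℝ≥0∞) : Set H :=
  {g | voiceL1Norm μ π v g g < ∞}

/-- The class of `g ∈ D(K)` with `V_g g ∈ W(L^∞, L^p_m, Q)`. The domain `D(K)` of the Duflo–Moore
operator `K` is the set of the admissible vectors, those with `V_g g ∈ L^2`. -/
def analyzingB (μ : Measure G) (π : G →* unitary (H →L[ℂ] H)) (Q : Set G) (p : ℝ)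
    (m : G → ℝ≥0∞) : Set H :=
  {g | MemLp (voice π g g) 2 μ ∧ MemWiener μ Q p m (voice π g g)}

/-- The class `𝔹^p_w = {g ∈ D(K) : V_g g ∈ W(L^∞, L^p_w, Q)}`. -/
def BSpace (μ : Measure G) (π : G →* unitary (H →L[ℂ] H)) (Q : Set G) (p : ℝ)
    (w : G → ℝ) : Set H :=
  analyzingB μ π Q p (toWeight w)

theorem voiceL1Norm_add_le [BorelSpace G] (μ : Measure G)
    {π : G →* unitary (H →L[ℂ] H)} (hπ : IsIrreducibleUnitaryRep π) (v : G → ℝ≥0∞) (g a b : H) :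
    voiceL1Norm μ π v g (a + b) ≤ 2 * voiceL1Norm μ π v g a + 2 * voiceL1Norm μ π v g b := by
  have hc : ∀ f : H, Continuous (voice π g f) := fun f => (hπ.continuous g).inner continuous_const
  have hS : MeasurableSet {x | ‖voice π g b x‖ₑ ≤ ‖voice π g a x‖ₑ} :=
    measurableSet_le (hc b).measurable.enorm (hc a).measurable.enorm
  have hadd : ∀ x, ‖voice π g (a + b) x‖ₑ ≤ ‖voice π g a x‖ₑ + ‖voice π g b x‖ₑ := by
    intro x
    simp only [voice, inner_add_right]
    exact enorm_add_le _ _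
  unfold voiceL1Norm
  rw [← lintegral_add_compl _ hS]
  have key : ∀ (c : H) (S : Set G), (∀ x ∈ S, ‖voice π g (a + b) x‖ₑ ≤ 2 * ‖voice π g c x‖ₑ) →
      MeasurableSet S → ∫⁻ x in S, ‖voice π g (a + b) x‖ₑ * v x ∂μ ≤
        2 * ∫⁻ x, ‖voice π g c x‖ₑ * v x ∂μ := by
    intro c S h hS
    rw [← lintegral_const_mul' _ _ (by simp)]
    refine le_trans (setLIntegral_mono' hS fun x hx => ?_) (setLIntegral_le_lintegral S _)
    rw [← mul_assoc]
    exact mul_le_mul_left (h x hx) _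
  refine add_le_add (key a _ (fun x hx => (hadd x).trans ?_) hS)
    (key b _ (fun x hx => (hadd x).trans ?_) hS.compl)
  · rw [two_mul]; exact add_le_add le_rfl hx
  · rw [two_mul]; exact add_le_add (le_of_lt (by simpa using hx)) le_rfl

/-- The space `H^1_v = {f ∈ H : V_g f ∈ L^1_v}`, for a fixed analyzing vector `g`. -/
def HOne [BorelSpace G] (μ : Measure G) {π : G →* unitary (H →L[ℂ] H)}
    (hπ : IsIrreducibleUnitaryRep π) (v : G → ℝ≥0∞) (g : H) : Submodule ℂ H where
  carrier := {f | voiceL1Norm μ π v g f < ∞}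
  add_mem' {a b} ha hb := (voiceL1Norm_add_le μ hπ v g a b).trans_lt
    (ENNReal.add_lt_top.mpr ⟨ENNReal.mul_lt_top (by simp) ha, ENNReal.mul_lt_top (by simp) hb⟩)
  zero_mem' := by simp [voiceL1Norm, voice]
  smul_mem' c f hf := by
    have h : voiceL1Norm μ π v g (c • f) = ‖c‖ₑ * voiceL1Norm μ π v g f := by
      simp only [voiceL1Norm, voice, inner_smul_right, enorm_mul, mul_assoc]
      exact lintegral_const_mul' _ _ enorm_ne_top
    exact h.trans_lt (ENNReal.mul_lt_top enorm_lt_top hf)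

/-- Membership in the anti-dual `(H^1_v)^¬`: the conjugate-linear functional `φ` on `H^1_v` is
bounded for the norm `‖h | H^1_v‖ = ‖V_g h | L^1_v‖`. -/
def IsBoundedAntifunctional [BorelSpace G] (μ : Measure G) {π : G →* unitary (H →L[ℂ] H)}
    (hπ : IsIrreducibleUnitaryRep π) (v : G → ℝ≥0∞) (g : H)
    (φ : HOne μ hπ v g →ₛₗ[starRingEnd ℂ] ℂ) : Prop :=
  ∃ C : ℝ≥0, ∀ h : HOne μ hπ v g, ‖φ h‖ₑ ≤ C * voiceL1Norm μ π v g h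

/-- The identification of `f ∈ H` with the conjugate-linear functional `h ↦ ⟨f, h⟩` on `H^1_v`. -/
def toAntifunctional [BorelSpace G] (μ : Measure G) {π : G →* unitary (H →L[ℂ] H)}
    (hπ : IsIrreducibleUnitaryRep π) (v : G → ℝ≥0∞) (g : H) (f : H) :
    HOne μ hπ v g →ₛₗ[starRingEnd ℂ] ℂ where
  toFun h := inner ℂ (h : H) f
  map_add' a b := inner_add_left (a : H) b f
  map_smul' c a := inner_smul_left (a : H) f c

/-- The class `𝔹(L^p_w) = 𝔹^p_{w'} ∩ 𝔸_v` of the vectors that define the coorbit space of `L^p_w`,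
where `w' = rightWeight` and `v = leftWeight`. -/
def BY [IsTopologicalGroup G] [LocallyCompactSpace G] (μ : Measure G)
    (π : G →* unitary (H →L[ℂ] H)) (Q : Set G) (p : ℝ) (w : G → ℝ) : Set H :=
  analyzingB μ π Q p (rightWeight μ Q p w) ∩ analyzingA μ π (leftWeight μ Q p w)

/-- The coorbit space `C(L^p_w) = {φ ∈ (H^1_v)^¬ : V_{g₀} φ ∈ W(L^∞, L^p_w, Q)}`, where
`v = leftWeight`, the space `H^1_v` is formed with `g₁`, the voice transform is
`V_{g₀} φ (x) = φ (π(x) g₀)`, and `hg₀` says that the orbit of `g₀` lies in `H^1_v`. -/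
def CoorbitSpace [BorelSpace G] (μ : Measure G) {π : G →* unitary (H →L[ℂ] H)}
    (hπ : IsIrreducibleUnitaryRep π) (Q : Set G) (p : ℝ) (w : G → ℝ) (g₁ g₀ : H)
    (hg₀ : ∀ x : G, (π x : H →L[ℂ] H) g₀ ∈ HOne μ hπ (leftWeight μ Q p w) g₁) :
    Set (HOne μ hπ (leftWeight μ Q p w) g₁ →ₛₗ[starRingEnd ℂ] ℂ) :=
  {φ | IsBoundedAntifunctional μ hπ (leftWeight μ Q p w) g₁ φ ∧
    MemWiener μ Q p (toWeight w) fun x => φ ⟨(π x : H →L[ℂ] H) g₀, hg₀ x⟩}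

end Representation

end Coorbit

end

set_option linter.unusedSectionVars false

namespace Coorbit

/-! An IN group has a relatively compact open neighbourhood `V` of the identity that is symmetric
and invariant under conjugation. Comparing the measures of `V` and of its images shows that Haar
measure is invariant under right translations and inversion. Since `xV = Vx`, local suprema over
left and right translates agree. Amalgam spaces are therefore stable under inversion and, for `p ≤
1`, closed under convolution: local suprema turn the integral of a product into an integral of a
locally almost constant function, for which `(∫ a)^p` is bounded by a multiple of `∫ b` with `b` a
local supremum of `a^p`.

Symmetry forces `w ≥ 1`, so one coefficient `V_g f` in the amalgam space is integrable, hence in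
`L²`. Schur's lemma, applied to the projection onto the graph of `h ↦ V_g h`, then gives the
orthogonality relations with a constant `κ ≠ 0`, and these give the reproducing formula `V_g f * V_h
k = κ⟨k, g⟩ V_h f`. Irreducibility allows `k` to be moved along its orbit so that `⟨k, g⟩ ≠ 0`. Thus
`V_h f` inherits amalgam membership from `V_g f` and `V_h k` (`IsOrthogonality.isAmalgam_voice`).
Since `|V_f g(x)| = |V_g f(x⁻¹)|`, both `V_f f` and `V_g g` follow from `V_g f`.

The operator norms of translations are comparable to `w`, from above by translating control
functions and from below by testing on the indicator of `V`. So `v` and `w'` may be replaced by `w`,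
and `𝔹(L^p_w) = 𝔹^p_w`.

For the coorbit space, vectors of `𝔹^p_w` give elements by the convolution argument, and injectivity
is totality of the orbit of `g₀`. For surjectivity, the transform of `φ` at `g₀` is integrable. A
bounded functional on `H^1_v` commutes with the integral `∫ V_{g₀}h(y) π(y)g₀ dy` that reproduces a
multiple of `h` (`IsOrthogonality.integral_voice_mul_functional`). Hence `φ` is bounded in the norm
of `H`, and the Riesz theorem supplies the vector. -/

theorem measure_ne_top_of_isCompact_closure {G : Type*} [TopologicalSpace G] [MeasurableSpace G]
    {μ : Measure G} [IsFiniteMeasureOnCompacts μ] {A : Set G}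
    (hA : IsCompact (closure A)) : μ A ≠ ∞ :=
  ((measure_mono subset_closure).trans_lt hA.measure_lt_top).ne

/-! ### Invariant neighbourhoods and unimodularity of IN groups. -/

section Group

variable {G : Type*} [Group G] [TopologicalSpace G] [IsTopologicalGroup G]

/-- A relatively compact open neighbourhood of the identity that is symmetric and invariant under
conjugation. -/
structure IsInvariantNhd (V : Set G) : Prop where
  isOpen : IsOpen V
  one_mem : (1 : G) ∈ V
  isCompact_closure : IsCompact (closure V)
  inv_mem : ∀ v ∈ V, v⁻¹ ∈ V
  conj_mem : ∀ x, ∀ v ∈ V, x * v * x⁻¹ ∈ V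

/-- Conjugation is a homeomorphism that maps the given compact set to itself, hence preserves its
interior. Intersecting the interior with its inverse adds symmetry. -/
theorem IsINGroup.exists_isInvariantNhd [T2Space G] (hG : IsINGroup G) :
    ∃ V : Set G, IsInvariantNhd V := by
  obtain ⟨K, hK, hK1, hx⟩ := hG
  have hconj : ∀ x : G, ∀ v ∈ interior K, x * v * x⁻¹ ∈ interior K := by
    intro x v hv
    let e : G ≃ₜ G := (Homeomorph.mulLeft x).trans (Homeomorph.mulRight x⁻¹)
    have h1 : e '' interior K ⊆ K := by
      rintro _ ⟨k, hk, rfl⟩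
      have : x * k ∈ (fun q => x * q) '' K := ⟨k, interior_subset hk, rfl⟩
      rw [hx x] at this
      obtain ⟨q, hq, hqe⟩ := this
      have : e k = q := by
        change x * k * x⁻¹ = q
        rw [← hqe]; simp
      rwa [this]
    exact interior_maximal h1 (e.isOpenMap _ isOpen_interior) ⟨v, hv, rfl⟩
  refine ⟨interior K ∩ (interior K)⁻¹, isOpen_interior.inter isOpen_interior.inv, ?_, ?_, ?_, ?_⟩
  · exact ⟨mem_interior_iff_mem_nhds.2 hK1, by simpa using mem_interior_iff_mem_nhds.2 hK1⟩
  · exact hK.of_isClosed_subset isClosed_closure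
      (closure_minimal (Set.inter_subset_left.trans interior_subset) hK.isClosed)
  · rintro v ⟨h1, h2⟩
    exact ⟨h2, by simpa using h1⟩
  · rintro x v ⟨h1, h2⟩
    refine ⟨hconj x v h1, ?_⟩
    have := hconj x v⁻¹ h2
    simpa [mul_assoc] using this

variable [LocallyCompactSpace G] [MeasurableSpace G] [BorelSpace G]

/-- Uniqueness of Haar measure leaves only a scalar factor, which is read off on `V`: the preimages
of `V` under left and right multiplication by `g` coincide, and `V` has positive finite measure. -/
theorem IsInvariantNhd.map_mul_right_eq_self {V : Set G} (hV : IsInvariantNhd V) (μ : Measure G)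
    [μ.IsHaarMeasure] [μ.Regular] (g : G) : μ.map (· * g) = μ := by
  have : (μ.map (· * g)).Regular := Measure.Regular.map (Homeomorph.mulRight g)
  have h := Measure.isMulLeftInvariant_eq_smul_of_regular (μ.map (· * g)) μ
  set c := Measure.haarScalarFactor (μ.map (· * g)) μ
  have h0 : μ V ≠ 0 := (hV.isOpen.measure_pos μ ⟨1, hV.one_mem⟩).ne'
  have ht : μ V ≠ ∞ := measure_ne_top_of_isCompact_closure hV.isCompact_closure
  have h1 : μ.map (· * g) V = μ V := by
    rw [Measure.map_apply (measurable_mul_const g) hV.isOpen.measurableSet]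
    have : (· * g) ⁻¹' V = (g * ·) ⁻¹' V := by
      ext y
      constructor
      · intro hy
        have := hV.conj_mem g _ hy
        simpa [mul_assoc] using this
      · intro hy
        have := hV.conj_mem g⁻¹ _ hy
        simpa [mul_assoc] using this
    rw [this, measure_preimage_mul]
  have h2 : c = 1 := by
    rw [h, Measure.smul_apply, ENNReal.smul_def, smul_eq_mul] at h1
    have : (c : ℝ≥0∞) = 1 := by
      rw [← ENNReal.mul_left_inj h0 ht, h1, one_mul]
    exact_mod_cast this
  rw [h, h2, one_smul]

theorem IsInvariantNhd.isMulRightInvariant {V : Set G} (hV : IsInvariantNhd V) (μ : Measure G)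
    [μ.IsHaarMeasure] [μ.Regular] : μ.IsMulRightInvariant :=
  ⟨hV.map_mul_right_eq_self μ⟩

theorem IsInvariantNhd.isInvInvariant {V : Set G} (hV : IsInvariantNhd V) (μ : Measure G)
    [μ.IsHaarMeasure] [μ.Regular] : μ.IsInvInvariant := by
  have := hV.isMulRightInvariant μ
  have : μ.inv.Regular := Measure.Regular.map (Homeomorph.inv G)
  have h := Measure.isMulLeftInvariant_eq_smul_of_regular μ.inv μ
  set c := Measure.haarScalarFactor μ.inv μ
  have h0 : μ V ≠ 0 := (hV.isOpen.measure_pos μ ⟨1, hV.one_mem⟩).ne'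
  have ht : μ V ≠ ∞ := measure_ne_top_of_isCompact_closure hV.isCompact_closure
  have h1 : μ.inv V = μ V := by
    rw [Measure.inv_apply]
    congr 1
    ext v
    exact ⟨fun hv => by simpa using hV.inv_mem _ hv, fun hv => hV.inv_mem _ hv⟩
  have h2 : c = 1 := by
    rw [h, Measure.smul_apply, ENNReal.smul_def, smul_eq_mul] at h1
    have : (c : ℝ≥0∞) = 1 := by
      rw [← ENNReal.mul_left_inj h0 ht, h1, one_mul]
    exact_mod_cast this
  exact ⟨by rw [h, h2, one_smul]⟩

theorem haarModule_eq_one (μ : Measure G) [μ.IsHaarMeasure] [μ.IsMulRightInvariant] (x : G) :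
    haarModule x = 1 := by
  change Measure.modularCharacterFun x⁻¹ = 1
  rw [Measure.modularCharacterFun_eq_haarScalarFactor μ]
  simp only [map_mul_right_eq_self]
  exact Measure.haarScalarFactor_self μ

end Group

/-! ### Symmetric submultiplicative weights. -/

section Weights

variable {G : Type*} [Group G] [TopologicalSpace G]

/-- A continuous finite symmetric submultiplicative weight that is bounded below by `1`. -/
structure IsSymmWeight (m : G → ℝ≥0∞) : Prop where
  continuous : Continuous m
  one_le : ∀ x, 1 ≤ m x
  ne_top : ∀ x, m x ≠ ∞
  mul_le : ∀ x y, m (x * y) ≤ m x * m y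
  inv : ∀ x, m x⁻¹ = m x

theorem IsSymmWeight.rpow {m : G → ℝ≥0∞} (hm : IsSymmWeight m) {p : ℝ} (hp : 0 < p) :
    IsSymmWeight fun x => m x ^ p where
  continuous := ENNReal.continuous_rpow_const.comp hm.continuous
  one_le x := ENNReal.one_le_rpow (hm.one_le x) hp
  ne_top x := ENNReal.rpow_ne_top_of_nonneg hp.le (hm.ne_top x)
  mul_le x y := by
    rw [← ENNReal.mul_rpow_of_nonneg _ _ hp.le]
    exact ENNReal.rpow_le_rpow (hm.mul_le x y) hp.le
  inv x := by rw [hm.inv]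

/-- The lower bound comes from symmetry: `w 1 ≤ w 1 ^ 2` gives `w 1 ≥ 1`, and then `1 ≤ w 1 ≤ w x *
w x⁻¹ = w x ^ 2`. -/
theorem IsSubmultiplicativeWeight.isSymmWeight_toWeight {w : G → ℝ}
    (hw : IsSubmultiplicativeWeight w) (hsymm : ∀ x, w x⁻¹ = w x) : IsSymmWeight (toWeight w) where
  continuous := ENNReal.continuous_ofReal.comp hw.continuous
  one_le x := by
    have h1 : w 1 ≤ w x * w x := by simpa [hsymm x] using hw.mul_le x x⁻¹
    have h2 : w 1 ≤ w 1 * w 1 := by simpa using hw.mul_le 1 1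
    have h3 := hw.pos x
    have h4 := hw.pos 1
    have h5 : 1 ≤ w 1 := by
      by_contra! h
      nlinarith
    rw [toWeight, ENNReal.one_le_ofReal]
    by_contra! h
    nlinarith
  ne_top x := ENNReal.ofReal_ne_top
  mul_le x y := by
    simp only [toWeight]
    rw [← ENNReal.ofReal_mul (hw.pos x).le]
    exact ENNReal.ofReal_le_ofReal (hw.mul_le x y)
  inv x := by simp only [toWeight, hsymm]

theorem IsSymmWeight.exists_bound {m : G → ℝ≥0∞} (hm : IsSymmWeight m) {A : Set G}
    (hA : IsCompact (closure A)) : ∃ C : ℝ≥0∞, C ≠ ∞ ∧ ∀ x ∈ A, m x ≤ C := by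
  rcases (closure A).eq_empty_or_nonempty with h | h
  · exact ⟨1, by simp, fun x hx => by
      have := subset_closure hx
      rw [h] at this
      exact this.elim⟩
  · obtain ⟨y, -, hy⟩ := hA.exists_isMaxOn h hm.continuous.continuousOn
    exact ⟨m y, hm.ne_top y, fun x hx => hy (subset_closure hx)⟩

end Weights

/-! ### Local suprema over translates. -/

section LocalSup

variable {G : Type*} [Group G]

/-- The supremum of `k` over the translate `xA`. -/
noncomputable def localSup (A : Set G) (k : G → ℝ≥0∞) (x : G) : ℝ≥0∞ := ⨆ a ∈ A, k (x * a)

theorem le_localSup {A : Set G} (k : G → ℝ≥0∞) (x : G) {a : G} (ha : a ∈ A) :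
    k (x * a) ≤ localSup A k x := le_iSup₂ (f := fun a (_ : a ∈ A) => k (x * a)) a ha

theorem self_le_localSup {A : Set G} (hA : 1 ∈ A) (k : G → ℝ≥0∞) (x : G) :
    k x ≤ localSup A k x := by simpa using le_localSup k x hA

theorem localSup_le {A : Set G} {k : G → ℝ≥0∞} {x : G} {c : ℝ≥0∞} (h : ∀ a ∈ A, k (x * a) ≤ c) :
    localSup A k x ≤ c := iSup₂_le h

theorem localSup_localSup_le (A B : Set G) (k : G → ℝ≥0∞) (x : G) :
    localSup A (localSup B k) x ≤ localSup (A * B) k x :=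
  localSup_le fun a ha => localSup_le fun b hb => by
    rw [mul_assoc]; exact le_localSup k x (Set.mul_mem_mul ha hb)

theorem localSup_rpow (A : Set G) (k : G → ℝ≥0∞) {p : ℝ} (hp : 0 < p) (x : G) :
    localSup A (fun y => k y ^ p) x = localSup A k x ^ p := by
  have h := fun (f : G → ℝ≥0∞) =>
    (ENNReal.orderIsoRpow p hp).map_iSup₂ fun a (_ : a ∈ A) => f (x * a)
  exact (h k).symm

theorem localSup_le_sum {A V : Set G} {T : Finset G} (hT : A ⊆ ⋃ t ∈ T, t • V) (k : G → ℝ≥0∞)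
    (x : G) : localSup A k x ≤ ∑ t ∈ T, localSup V k (x * t) := by
  refine localSup_le fun a ha => ?_
  obtain ⟨t, ht, v, hv, rfl⟩ : ∃ t ∈ T, ∃ v ∈ V, t * v = a := by
    simpa [Set.mem_smul_set] using hT ha
  calc k (x * (t * v)) = k (x * t * v) := by rw [mul_assoc]
    _ ≤ localSup V k (x * t) := le_localSup _ _ hv
    _ ≤ _ := Finset.single_le_sum (f := fun t => localSup V k (x * t)) (fun _ _ => zero_le) ht

variable [TopologicalSpace G] [IsTopologicalGroup G]

theorem lowerSemicontinuous_localSup {k : G → ℝ≥0∞} (hk : LowerSemicontinuous k) (A : Set G) :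
    LowerSemicontinuous (localSup A k) :=
  lowerSemicontinuous_biSup fun a _ => hk.comp (continuous_mul_const a)

/-- A point of `xA` where `k` exceeds a level still lies in `yA` for `y` near `x`, so no regularity
of `k` is needed. This supplies measurable majorants for functions not known to be measurable. -/
theorem lowerSemicontinuous_localSup_of_isOpen {A : Set G} (hA : IsOpen A) (k : G → ℝ≥0∞) :
    LowerSemicontinuous (localSup A k) := by
  intro x c hc
  obtain ⟨a, ha, hac⟩ : ∃ a ∈ A, c < k (x * a) := by
    simpa [localSup, lt_iSup_iff] using hc
  have h1 : ∀ᶠ y in 𝓝 x, y⁻¹ * (x * a) ∈ A :=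
    ContinuousAt.eventually_mem (f := fun y : G => y⁻¹ * (x * a)) (by fun_prop)
      (by simpa using hA.mem_nhds ha)
  filter_upwards [h1] with y hy
  exact hac.trans_le (by simpa using le_localSup k y hy)

theorem exists_finset_cover {A V : Set G} (hA : IsCompact (closure A)) (hV : IsOpen V)
    (h1 : (1 : G) ∈ V) : ∃ T : Finset G, A ⊆ ⋃ t ∈ T, t • V := by
  obtain ⟨T, hT⟩ := hA.elim_finite_subcover (fun t : G => t • V) (fun t => hV.smul t)
    (fun x _ => Set.mem_iUnion.2 ⟨x, 1, h1, by simp⟩)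
  exact ⟨T, subset_closure.trans hT⟩

theorem isCompact_closure_mul [T2Space G] {A B : Set G} (hA : IsCompact (closure A))
    (hB : IsCompact (closure B)) : IsCompact (closure (A * B)) :=
  (hA.mul hB).closure_of_subset (Set.mul_subset_mul subset_closure subset_closure)

end LocalSup

/-! ### Amalgam spaces: translation, inversion and change of exponent. -/

section Amalgam

variable {G : Type*} [Group G] [TopologicalSpace G] [MeasurableSpace G]

/-- The nonnegative function `k` is lower semicontinuous, and its suprema over the translates of
any relatively compact set are integrable against `m`. -/
structure IsAmalgam (μ : Measure G) (m k : G → ℝ≥0∞) : Prop where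
  lsc : LowerSemicontinuous k
  lintegral_lt_top : ∀ A : Set G, IsCompact (closure A) → ∫⁻ x, localSup A k x * m x ∂μ < ∞

variable [BorelSpace G] {μ : Measure G} {m k : G → ℝ≥0∞}

end Amalgam

section AmalgamGroup

variable {G : Type*} [Group G] [TopologicalSpace G] [IsTopologicalGroup G] [LocallyCompactSpace G]
  [T2Space G] [MeasurableSpace G] [BorelSpace G] {μ : Measure G} {m k : G → ℝ≥0∞}

theorem IsAmalgam.lintegral_mul_lt_top (hk : IsAmalgam μ m k) : ∫⁻ x, k x * m x ∂μ < ∞ := by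
  refine lt_of_le_of_lt (lintegral_mono fun x => ?_)
    (hk.lintegral_lt_top {1} (by simp))
  gcongr
  exact self_le_localSup (Set.mem_singleton 1) k x

theorem lintegral_mul_right_weight_le [μ.IsMulRightInvariant] (hm : IsSymmWeight m)
    (f : G → ℝ≥0∞) (t : G) : ∫⁻ x, f (x * t) * m x ∂μ ≤ m t * ∫⁻ x, f x * m x ∂μ := by
  rw [← lintegral_mul_right_eq_self (fun x => f x * m x) t,
    ← lintegral_const_mul' _ _ (hm.ne_top t)]
  refine lintegral_mono fun x => ?_
  have : m x ≤ m t * m (x * t) := by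
    have := hm.mul_le (x * t) t⁻¹
    rwa [mul_inv_cancel_right, hm.inv, mul_comm] at this
  calc f (x * t) * m x ≤ f (x * t) * (m t * m (x * t)) := by gcongr
    _ = _ := by ring

theorem lintegral_mul_left_weight_le [μ.IsMulLeftInvariant] (hm : IsSymmWeight m)
    (f : G → ℝ≥0∞) (z : G) : ∫⁻ x, f (z⁻¹ * x) * m x ∂μ ≤ m z * ∫⁻ x, f x * m x ∂μ := by
  rw [← lintegral_mul_left_eq_self (fun x => f x * m x) z⁻¹,
    ← lintegral_const_mul' _ _ (hm.ne_top z)]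
  refine lintegral_mono fun x => ?_
  have : m x ≤ m z * m (z⁻¹ * x) := by simpa using hm.mul_le z (z⁻¹ * x)
  calc f (z⁻¹ * x) * m x ≤ f (z⁻¹ * x) * (m z * m (z⁻¹ * x)) := by gcongr
    _ = _ := by ring

/-- It suffices to control the suprema over the translates of one open neighbourhood. -/
theorem isAmalgam_of_isOpen [μ.IsMulRightInvariant] (hm : IsSymmWeight m)
    (hk : LowerSemicontinuous k) {V : Set G} (hV : IsOpen V) (h1 : 1 ∈ V)
    (h : ∫⁻ x, localSup V k x * m x ∂μ < ∞) : IsAmalgam μ m k := by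
  refine ⟨hk, fun A hA => ?_⟩
  obtain ⟨T, hT⟩ := exists_finset_cover hA hV h1
  calc ∫⁻ x, localSup A k x * m x ∂μ
      ≤ ∫⁻ x, ∑ t ∈ T, localSup V k (x * t) * m x ∂μ := by
        refine lintegral_mono fun x => ?_
        rw [← Finset.sum_mul]
        gcongr
        exact localSup_le_sum hT k x
    _ = ∑ t ∈ T, ∫⁻ x, localSup V k (x * t) * m x ∂μ :=
        lintegral_finsetSum _ fun t _ =>
          (((lowerSemicontinuous_localSup hk V).measurable).comp (measurable_mul_const t)).mul
            hm.continuous.measurable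
    _ ≤ ∑ t ∈ T, m t * ∫⁻ x, localSup V k x * m x ∂μ :=
        Finset.sum_le_sum fun t _ => lintegral_mul_right_weight_le hm _ t
    _ < ∞ := ENNReal.sum_lt_top.2 fun t _ => ENNReal.mul_lt_top (hm.ne_top t).lt_top h

theorem IsAmalgam.leftTranslate [μ.IsMulLeftInvariant] (hm : IsSymmWeight m)
    (hk : IsAmalgam μ m k) (z : G) : IsAmalgam μ m fun x => k (z⁻¹ * x) := by
  refine ⟨hk.lsc.comp (continuous_const_mul z⁻¹), fun A hA => ?_⟩
  have h : ∀ x, localSup A (fun x => k (z⁻¹ * x)) x = localSup A k (z⁻¹ * x) := fun x => by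
    simp only [localSup, mul_assoc]
  simp only [h]
  exact (lintegral_mul_left_weight_le hm _ z).trans_lt
    (ENNReal.mul_lt_top (hm.ne_top z).lt_top (hk.lintegral_lt_top A hA))

theorem isAmalgam_localSup (hk : IsAmalgam μ m k) {B : Set G} (hB : IsCompact (closure B)) :
    IsAmalgam μ m (localSup B k) := by
  refine ⟨lowerSemicontinuous_localSup hk.lsc B, fun A hA => ?_⟩
  refine lt_of_le_of_lt (lintegral_mono fun x => ?_)
    (hk.lintegral_lt_top _ (isCompact_closure_mul hA hB))
  gcongr
  exact localSup_localSup_le A B k x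

/-- Here `(xv)⁻¹ = x⁻¹ (x v⁻¹ x⁻¹)`, and the second factor is in `V` by conjugation invariance. This
is what makes amalgam spaces stable under inversion. -/
theorem IsInvariantNhd.localSup_comp_inv_le {V : Set G} (hV : IsInvariantNhd V) (k : G → ℝ≥0∞)
    (x : G) : localSup V (fun y => k y⁻¹) x ≤ localSup V k x⁻¹ := by
  refine localSup_le fun v hv => ?_
  have h := hV.conj_mem x _ (hV.inv_mem v hv)
  simpa [mul_assoc] using le_localSup k x⁻¹ h

theorem IsAmalgam.comp_inv {V : Set G} (hV : IsInvariantNhd V) [μ.IsMulRightInvariant]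
    [μ.IsInvInvariant] (hm : IsSymmWeight m) (hk : IsAmalgam μ m k) :
    IsAmalgam μ m fun x => k x⁻¹ := by
  refine isAmalgam_of_isOpen hm (hk.lsc.comp continuous_inv) hV.isOpen hV.one_mem ?_
  calc ∫⁻ x, localSup V (fun x => k x⁻¹) x * m x ∂μ
      ≤ ∫⁻ x, localSup V k x⁻¹ * m x⁻¹ ∂μ := by
        refine lintegral_mono fun x => ?_
        rw [hm.inv]
        gcongr
        exact hV.localSup_comp_inv_le k x
    _ = ∫⁻ x, localSup V k x * m x ∂μ :=
        lintegral_inv_eq_self (fun x => localSup V k x * m x)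
    _ < ∞ := hk.lintegral_lt_top V hV.isCompact_closure

theorem mul_measure_le_lintegral [μ.IsMulLeftInvariant] {V : Set G} (hV : IsOpen V) {c : ℝ≥0∞}
    {b : G → ℝ≥0∞} (x : G) (h : ∀ v ∈ V, c ≤ b (x * v)) : c * μ V ≤ ∫⁻ y, b y ∂μ := by
  rw [← setLIntegral_const, ← lintegral_mul_left_eq_self b x]
  exact (setLIntegral_mono' hV.measurableSet h).trans (setLIntegral_le_lintegral _ _)

/-- Write `t = (t^p)^((1-p)/p) * t^p` and bound the first factor; its exponent is nonnegative
because `p ≤ 1`. -/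
theorem lintegral_le_of_rpow_le {t : G → ℝ≥0∞} {p : ℝ} (hp0 : 0 < p) (hp1 : p ≤ 1) {M : ℝ≥0∞}
    (hM : M ≠ ∞) (h : ∀ x, t x ^ p ≤ M) :
    ∫⁻ x, t x ∂μ ≤ M ^ ((1 - p) / p) * ∫⁻ x, t x ^ p ∂μ := by
  have hq : 0 ≤ (1 - p) / p := div_nonneg (by linarith) hp0.le
  rw [← lintegral_const_mul' _ _ (ENNReal.rpow_ne_top_of_nonneg hq hM)]
  refine lintegral_mono fun x => ?_
  calc t x = (t x ^ p) ^ ((1 - p) / p) * t x ^ p := by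
        rw [← ENNReal.rpow_mul, ← ENNReal.rpow_add_of_nonneg _ _ (by positivity) hp0.le,
          mul_div_cancel₀ _ hp0.ne', sub_add_cancel, ENNReal.rpow_one]
    _ ≤ _ := by gcongr; exact h x

/-- For `0 < p ≤ 1`, a nonnegative function in `W(L^∞, L^p_m)` is in `W(L^∞, L^1_m)`. -/
theorem IsAmalgam.of_rpow {V : Set G} (hV : IsInvariantNhd V) [μ.IsHaarMeasure]
    [μ.IsMulRightInvariant] (hm : IsSymmWeight m) {p : ℝ} (hp0 : 0 < p) (hp1 : p ≤ 1)
    (hk : LowerSemicontinuous k) (h : IsAmalgam μ (fun x => m x ^ p) fun x => k x ^ p) :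
    IsAmalgam μ m k := by
  refine isAmalgam_of_isOpen hm hk hV.isOpen hV.one_mem ?_
  obtain ⟨C, hC, hCm⟩ := hm.exists_bound hV.isCompact_closure
  have hVV := isCompact_closure_mul hV.isCompact_closure hV.isCompact_closure
  set I := ∫⁻ x, localSup (V * V) (fun x => k x ^ p) x * m x ^ p ∂μ
  have hI : I < ∞ := h.lintegral_lt_top _ hVV
  have h0 : μ V ≠ 0 := (hV.isOpen.measure_pos μ ⟨1, hV.one_mem⟩).ne'
  have ht : μ V ≠ ∞ := measure_ne_top_of_isCompact_closure hV.isCompact_closure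
  have hCp : C ^ p ≠ ∞ := ENNReal.rpow_ne_top_of_nonneg hp0.le hC
  have hM : C ^ p * I / μ V ≠ ∞ := (ENNReal.div_lt_top (ENNReal.mul_ne_top hCp hI.ne) h0).ne
  -- The supremum over `xV` is at most the one over `xvVV` for every `v ∈ V`, since `V` is
  -- symmetric. The value at `x` thus persists on a set of measure `μ V`, and integrability of the
  -- larger supremum bounds the smaller one uniformly.
  have hb : ∀ x, (localSup V k x * m x) ^ p ≤ C ^ p * I / μ V := by
    intro x
    rw [ENNReal.le_div_iff_mul_le (Or.inl h0) (Or.inl ht), ← lintegral_const_mul' _ _ hCp]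
    refine mul_measure_le_lintegral hV.isOpen x fun v hv => ?_
    rw [localSup_rpow _ _ hp0, ← ENNReal.mul_rpow_of_nonneg _ _ hp0.le,
      ← ENNReal.mul_rpow_of_nonneg _ _ hp0.le]
    refine ENNReal.rpow_le_rpow ?_ hp0.le
    have h1 : localSup V k x ≤ localSup (V * V) k (x * v) :=
      localSup_le fun a ha => by
        simpa [mul_assoc] using le_localSup k (x * v) (Set.mul_mem_mul (hV.inv_mem v hv) ha)
    have h2 : m x ≤ C * m (x * v) := by
      calc m x ≤ m (x * v) * m v⁻¹ := by simpa using hm.mul_le (x * v) v⁻¹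
        _ ≤ m (x * v) * C := by rw [hm.inv]; gcongr; exact hCm v hv
        _ = _ := mul_comm _ _
    calc _ ≤ localSup (V * V) k (x * v) * (C * m (x * v)) := by gcongr
      _ = _ := by ring
  refine (lintegral_le_of_rpow_le hp0 hp1 hM hb).trans_lt (ENNReal.mul_lt_top
    (ENNReal.rpow_lt_top_of_nonneg (div_nonneg (by linarith) hp0.le) hM) ?_)
  refine lt_of_le_of_lt (lintegral_mono fun x => ?_) (h.lintegral_lt_top V hV.isCompact_closure)
  rw [localSup_rpow _ _ hp0, ENNReal.mul_rpow_of_nonneg _ _ hp0.le]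

end AmalgamGroup

/-! ### Countable discretization and convolution of amalgam spaces. -/

section Discretization

variable {G : Type*} [Group G] [TopologicalSpace G] [IsTopologicalGroup G] [LocallyCompactSpace G]
  [T2Space G] [MeasurableSpace G] [BorelSpace G]

/-- The measurable sets `E n ⊆ x n • U` are pairwise disjoint and cover the set where `A ≠ 0`. -/
structure IsDiscretization (U : Set G) (A : G → ℝ≥0∞) (x : ℕ → G) (E : ℕ → Set G) : Prop where
  measurableSet : ∀ n, MeasurableSet (E n)
  disjoint : Pairwise (Function.onFun Disjoint E)
  mem : ∀ n, ∀ y ∈ E n, (x n)⁻¹ * y ∈ U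
  cover : ∀ y, A y ≠ 0 → ∃ n, y ∈ E n

/-- The support of an integrable lower semicontinuous function is covered by countably many
translates of any neighbourhood of the identity. -/
theorem exists_isDiscretization (μ : Measure G) [μ.IsHaarMeasure] {A : G → ℝ≥0∞}
    (hA : LowerSemicontinuous A) (hfin : ∫⁻ y, A y ∂μ ≠ ∞) {U : Set G} (hU : U ∈ 𝓝 (1 : G)) :
    ∃ (x : ℕ → G) (E : ℕ → Set G), IsDiscretization U A x E := by
  obtain ⟨V, hV, hV1, hVU⟩ : ∃ V : Set G, IsOpen V ∧ 1 ∈ V ∧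
      ∀ v ∈ V, ∀ w ∈ V, v * w⁻¹ ∈ interior U := by
    have h : ∀ᶠ q : G × G in 𝓝 (1, 1), q.1 * q.2⁻¹ ∈ interior U :=
      ContinuousAt.eventually_mem (f := fun q : G × G => q.1 * q.2⁻¹) (by fun_prop)
        (by simpa using interior_mem_nhds.2 hU)
    obtain ⟨V, hV, h1, hVU⟩ := exists_nhds_square (s := {q : G × G | q.1 * q.2⁻¹ ∈ interior U})
      (x := (1 : G)) h
    exact ⟨V, hV, h1, fun v hv w hw => hVU (Set.mk_mem_prod hv hw)⟩
  let S : Set G := {y | A y ≠ 0}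
  have hS : IsOpen S := by
    have : S = A ⁻¹' Set.Ioi 0 := by ext y; simp [S, pos_iff_ne_zero]
    rw [this]; exact hA.isOpen_preimage 0
  -- The centres form a maximal subset of the support whose translates of `V` are disjoint. The
  -- group need not be σ-compact: countability comes from the finite measure with density `A`, which
  -- charges each translate, and maximality makes the sets `xVV⁻¹` cover the support.
  obtain ⟨X, ⟨hXS, hXd⟩, hXmax⟩ : ∃ X : Set G, Maximal
      (fun s => s ∈ {s : Set G | s ⊆ S ∧ s.PairwiseDisjoint fun x => x • V}) X := by
    refine zorn_subset _ fun c hc hchain => ⟨⋃₀ c, ⟨?_, ?_⟩, fun s hs =>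
      Set.subset_sUnion_of_mem hs⟩
    · exact Set.sUnion_subset fun s hs => (hc hs).1
    · exact (Set.pairwiseDisjoint_sUnion hchain.directedOn).2 fun s hs => (hc hs).2
  have hXc : X.Countable := by
    have : IsFiniteMeasure (μ.withDensity A) := isFiniteMeasure_withDensity hfin
    have h := Measure.countable_meas_pos_of_disjoint_iUnion (μ := μ.withDensity A)
      (As := fun x : X => (x : G) • V) (fun x => (hV.smul (x : G)).measurableSet)
      (fun x y hxy => hXd x.2 y.2 fun h => hxy (Subtype.ext h))
    have h2 : {i : X | 0 < μ.withDensity A ((i : G) • V)} = Set.univ := by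
      refine Set.eq_univ_of_forall fun x => ?_
      rw [Set.mem_ofPred_eq, withDensity_apply _ (hV.smul (x : G)).measurableSet, pos_iff_ne_zero,
        Ne, setLIntegral_eq_zero_iff (hV.smul (x : G)).measurableSet hA.measurable]
      intro h0
      have h3 : μ ((x : G) • V ∩ S) = 0 := by
        rw [ae_iff] at h0
        convert h0 using 2
        ext y; simp [S]
      exact (((hV.smul (x : G)).inter hS).measure_pos μ
        ⟨x, ⟨1, hV1, by simp⟩, hXS x.2⟩).ne' h3
    rw [h2] at h
    exact Set.countable_coe_iff.1 (Set.countable_univ_iff.1 h)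
  have hcov : ∀ y ∈ S, ∃ x ∈ X, x⁻¹ * y ∈ interior U := by
    intro y hy
    by_contra! hcon
    have hyX : y ∉ X := fun h => hcon y h (by simpa using hVU 1 hV1 1 hV1)
    refine hyX (hXmax (y := insert y X) ⟨Set.insert_subset hy hXS, ?_⟩ (Set.subset_insert _ _)
      (Set.mem_insert _ _))
    rw [Set.pairwiseDisjoint_insert_of_notMem hyX]
    refine ⟨hXd, fun x hx => Set.disjoint_left.2 ?_⟩
    rintro z ⟨v, hv, rfl⟩ ⟨u, hu, hz⟩
    refine hcon x hx ?_
    have : x⁻¹ * y = u * v⁻¹ := by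
      simp only [smul_eq_mul] at hz
      rw [eq_mul_inv_iff_mul_eq, mul_assoc, ← hz, inv_mul_cancel_left]
    rw [this]; exact hVU u hu v hv
  rcases X.eq_empty_or_nonempty with rfl | hne
  · refine ⟨fun _ => 1, fun _ => ∅, fun _ => .empty, fun _ _ _ => by simp [Function.onFun],
      fun _ _ h => h.elim, fun y hy => ?_⟩
    obtain ⟨x, hx, -⟩ := hcov y hy
    exact hx.elim
  · obtain ⟨x, rfl⟩ := hXc.exists_eq_range hne
    refine ⟨x, disjointed fun n => x n • interior U, fun n => ?_, disjoint_disjointed _,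
      fun n y hy => ?_, fun y hy => ?_⟩
    · exact MeasurableSet.disjointed (fun n => (isOpen_interior.smul (x n)).measurableSet) n
    · obtain ⟨u, hu, rfl⟩ := disjointed_subset _ n hy
      simpa using interior_subset hu
    · obtain ⟨_, ⟨n, rfl⟩, hn⟩ := hcov y hy
      have : y ∈ ⋃ n, x n • interior U := Set.mem_iUnion.2 ⟨n, Set.mem_smul_set.2 ⟨_, hn, by simp⟩⟩
      rw [← iUnion_disjointed] at this
      exact Set.mem_iUnion.1 this

variable {μ : Measure G} {m k A : G → ℝ≥0∞} {U : Set G} {x : ℕ → G} {E : ℕ → Set G}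

theorem IsDiscretization.lintegral_mul_eq_tsum (h : IsDiscretization U A x E) (f : G → ℝ≥0∞) :
    ∫⁻ y, A y * f y ∂μ = ∑' n, ∫⁻ y in E n, A y * f y ∂μ := by
  rw [← lintegral_iUnion h.measurableSet h.disjoint, setLIntegral_eq_of_support_subset]
  intro y hy
  obtain ⟨n, hn⟩ := h.cover y (left_ne_zero_of_mul hy)
  exact Set.mem_iUnion.2 ⟨n, hn⟩

/-- Each cell lies in a translate of `U`, so the weight at its centre is at most `C` times the
weight at any of its points. -/
theorem IsDiscretization.tsum_mul_le (h : IsDiscretization U A x E) (hm : IsSymmWeight m)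
    {C : ℝ≥0∞} (hC : C ≠ ∞) (hCm : ∀ u ∈ U, m u ≤ C) :
    ∑' n, (∫⁻ y in E n, A y ∂μ) * m (x n) ≤ C * ∫⁻ y, A y * m y ∂μ := by
  rw [h.lintegral_mul_eq_tsum, ← ENNReal.tsum_mul_left]
  refine ENNReal.tsum_le_tsum fun n => ?_
  rw [← lintegral_mul_const' _ _ (hm.ne_top _), ← lintegral_const_mul' _ _ hC]
  refine setLIntegral_mono' (h.measurableSet n) fun y hy => ?_
  have h1 : m (x n) ≤ m y * C := by
    calc m (x n) ≤ m y * m (y⁻¹ * x n) := by simpa using hm.mul_le y (y⁻¹ * x n)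
      _ ≤ m y * C := by
        gcongr
        rw [← hm.inv]
        simpa using hCm _ (h.mem n y hy)
  calc A y * m (x n) ≤ A y * (m y * C) := by gcongr
    _ = _ := by ring

/-- The convolution relation `L^1_m * W(L^∞, L^1_m) ⊆ W(L^∞, L^1_m)`. -/
theorem IsAmalgam.of_le_convolution {V : Set G} (hV : IsInvariantNhd V) [μ.IsHaarMeasure]
    [μ.IsMulRightInvariant] (hm : IsSymmWeight m) (hA : LowerSemicontinuous A)
    (hAm : ∫⁻ y, A y * m y ∂μ < ∞) (hk : IsAmalgam μ m k) {l : G → ℝ≥0∞}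
    (hl : LowerSemicontinuous l) {c : ℝ≥0∞} (hc : c ≠ ∞)
    (h : ∀ z, l z ≤ c * ∫⁻ y, A y * k (y⁻¹ * z) ∂μ) : IsAmalgam μ m l := by
  have hAfin : ∫⁻ y, A y ∂μ ≠ ∞ := by
    refine (lt_of_le_of_lt (lintegral_mono fun y => ?_) hAm).ne
    simpa using mul_le_mul_right (hm.one_le y) (A y)
  obtain ⟨x, E, hE⟩ := exists_isDiscretization μ hA hAfin (hV.isOpen.mem_nhds hV.one_mem)
  obtain ⟨C, hC, hCm⟩ := hm.exists_bound hV.isCompact_closure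
  set α : ℕ → ℝ≥0∞ := fun n => ∫⁻ y in E n, A y ∂μ
  have hα : ∀ n, α n ≠ ∞ := fun n => ((setLIntegral_le_lintegral _ _).trans_lt hAfin.lt_top).ne
  set k' := localSup V k
  have hk' : IsAmalgam μ m k' := isAmalgam_localSup hk hV.isCompact_closure
  have hl' : ∀ z, l z ≤ c * ∑' n, α n * k' ((x n)⁻¹ * z) := by
    intro z
    refine (h z).trans ?_
    rw [hE.lintegral_mul_eq_tsum]
    gcongr with n
    -- When the supremum is infinite, the product with `α n = 0` is zero by convention; the integral
    -- also vanishes then, because `A` is zero almost everywhere on the cell.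
    rcases eq_or_ne (k' ((x n)⁻¹ * z)) ∞ with htop | htop
    · rcases eq_or_ne (α n) 0 with h0 | h0
      · have := (setLIntegral_eq_zero_iff (hE.measurableSet n) hA.measurable).1 h0
        rw [h0, zero_mul, nonpos_iff_eq_zero]
        refine (lintegral_eq_zero_of_ae_eq_zero ?_)
        rw [Filter.EventuallyEq, ae_restrict_iff' (hE.measurableSet n)]
        filter_upwards [this] with y hy hyE
        simp [hy hyE]
      · simp [htop, h0]
    · rw [← lintegral_mul_const' _ _ htop]
      refine setLIntegral_mono' (hE.measurableSet n) fun y hy => ?_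
      gcongr
      -- For `u = (x n)⁻¹ * y ∈ V`, the point `y⁻¹z = u⁻¹ (x n)⁻¹ z` equals `(x n)⁻¹ z` times a
      -- conjugate of `u⁻¹`, so `k` there is at most `k'`.
      have h1 := hV.conj_mem ((x n)⁻¹ * z)⁻¹ _ (hV.inv_mem _ (hE.mem n y hy))
      have h2 := le_localSup k ((x n)⁻¹ * z) h1
      simpa [mul_assoc] using h2
  refine isAmalgam_of_isOpen hm hl hV.isOpen hV.one_mem ?_
  set k'' := localSup V k'
  have hk'' : LowerSemicontinuous k'' := lowerSemicontinuous_localSup hk'.lsc V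
  calc ∫⁻ z, localSup V l z * m z ∂μ
      ≤ ∫⁻ z, c * ∑' n, α n * (k'' ((x n)⁻¹ * z) * m z) ∂μ := by
        refine lintegral_mono fun z => ?_
        simp only [← mul_assoc, ENNReal.tsum_mul_right]
        gcongr
        refine localSup_le fun v hv => (hl' _).trans ?_
        gcongr with n
        rw [← mul_assoc]
        exact le_localSup k' _ hv
    _ = c * ∑' n, α n * ∫⁻ z, k'' ((x n)⁻¹ * z) * m z ∂μ := by
        rw [lintegral_const_mul' _ _ hc, lintegral_tsum]
        · simp_rw [lintegral_const_mul' _ _ (hα _)]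
        · intro n
          exact (((hk''.measurable.comp (measurable_const_mul _)).mul
            hm.continuous.measurable).const_mul _).aemeasurable
    _ ≤ c * ∑' n, α n * (m (x n) * ∫⁻ z, k'' z * m z ∂μ) := by
        gcongr with n
        exact lintegral_mul_left_weight_le hm k'' (x n)
    _ = c * ((∑' n, α n * m (x n)) * ∫⁻ z, k'' z * m z ∂μ) := by
        simp_rw [← mul_assoc, ENNReal.tsum_mul_right]
        rw [mul_assoc]
    _ < ∞ := ENNReal.mul_lt_top hc.lt_top (ENNReal.mul_lt_top
        ((hE.tsum_mul_le hm hC hCm).trans_lt (ENNReal.mul_lt_top hC.lt_top hAm))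
        (hk'.lintegral_lt_top V hV.isCompact_closure))

/-- A substitute for subadditivity of the `p`-th power. The hypothesis gives the uniform bound `a^p
≤ ∫ b / μ V`, so `∫ a ≤ (∫ b / μ V)^((1-p)/p) * ∫ b`; raising this to the power `p` leaves `∫ b` to
the first power. -/
theorem lintegral_rpow_le_of_translate_le {V : Set G} (hV : IsInvariantNhd V) [μ.IsHaarMeasure]
    {p : ℝ} (hp0 : 0 < p) (hp1 : p ≤ 1) {a b : G → ℝ≥0∞}
    (h : ∀ y, ∀ v ∈ V, a y ^ p ≤ b (y * v)) :
    (∫⁻ y, a y ∂μ) ^ p ≤ (μ V ^ (1 - p))⁻¹ * ∫⁻ y, b y ∂μ := by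
  have h0 : μ V ≠ 0 := (hV.isOpen.measure_pos μ ⟨1, hV.one_mem⟩).ne'
  have ht : μ V ≠ ∞ := measure_ne_top_of_isCompact_closure hV.isCompact_closure
  have hq : 0 ≤ 1 - p := by linarith
  rcases eq_or_ne (∫⁻ y, b y ∂μ) ∞ with htop | htop
  · rw [htop, ENNReal.mul_top (ENNReal.inv_ne_zero.2 (ENNReal.rpow_ne_top_of_nonneg hq ht))]
    exact le_top
  have hb : ∀ y, a y ^ p ≤ (∫⁻ y, b y ∂μ) / μ V := fun y => by
    rw [ENNReal.le_div_iff_mul_le (Or.inl h0) (Or.inl ht)]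
    exact mul_measure_le_lintegral hV.isOpen y (h y)
  have hM : (∫⁻ y, b y ∂μ) / μ V ≠ ∞ := (ENNReal.div_lt_top htop h0).ne
  have hab : ∫⁻ y, a y ^ p ∂μ ≤ ∫⁻ y, b y ∂μ :=
    lintegral_mono fun y => by simpa using h y 1 hV.one_mem
  calc (∫⁻ y, a y ∂μ) ^ p
      ≤ (((∫⁻ y, b y ∂μ) / μ V) ^ ((1 - p) / p) * ∫⁻ y, b y ∂μ) ^ p := by
        refine ENNReal.rpow_le_rpow ((lintegral_le_of_rpow_le hp0 hp1 hM hb).trans ?_) hp0.le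
        gcongr
    _ = (μ V ^ (1 - p))⁻¹ * ((∫⁻ y, b y ∂μ) ^ (1 - p) * (∫⁻ y, b y ∂μ) ^ p) := by
        rw [ENNReal.mul_rpow_of_nonneg _ _ hp0.le, ← ENNReal.rpow_mul, div_mul_cancel₀ _ hp0.ne',
          ENNReal.div_rpow_of_nonneg _ _ hq, ENNReal.div_eq_inv_mul, mul_assoc]
    _ = _ := by rw [← ENNReal.rpow_add_of_nonneg _ _ hq hp0.le, sub_add_cancel, ENNReal.rpow_one]

/-- For `0 < p ≤ 1`, the amalgam space `W(L^∞, L^p_m)` on an IN group is closed under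
convolution. -/
theorem IsAmalgam.of_le_convolution_rpow {V : Set G} (hV : IsInvariantNhd V) [μ.IsHaarMeasure]
    [μ.IsMulRightInvariant] (hm : IsSymmWeight m) {p : ℝ} (hp0 : 0 < p) (hp1 : p ≤ 1)
    (hA : IsAmalgam μ m fun x => A x ^ p) (hk : IsAmalgam μ m fun x => k x ^ p)
    {l : G → ℝ≥0∞} (hl : LowerSemicontinuous fun x => l x ^ p) {c : ℝ≥0∞} (hc : c ≠ ∞)
    (h : ∀ z, l z ≤ c * ∫⁻ y, A y * k (y⁻¹ * z) ∂μ) : IsAmalgam μ m fun x => l x ^ p := by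
  have h0 : μ V ≠ 0 := (hV.isOpen.measure_pos μ ⟨1, hV.one_mem⟩).ne'
  have ht : μ V ≠ ∞ := measure_ne_top_of_isCompact_closure hV.isCompact_closure
  have hA' := isAmalgam_localSup hA hV.isCompact_closure
  have hk' := isAmalgam_localSup hk hV.isCompact_closure
  refine IsAmalgam.of_le_convolution hV hm hA'.lsc hA'.lintegral_mul_lt_top hk' hl
    (c := c ^ p * (μ V ^ (1 - p))⁻¹) (ENNReal.mul_ne_top
      (ENNReal.rpow_ne_top_of_nonneg hp0.le hc) (ENNReal.inv_ne_top.2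
        (ENNReal.rpow_pos (pos_iff_ne_zero.2 h0) ht).ne')) fun z => ?_
  calc l z ^ p ≤ (c * ∫⁻ y, A y * k (y⁻¹ * z) ∂μ) ^ p := ENNReal.rpow_le_rpow (h z) hp0.le
    _ = c ^ p * (∫⁻ y, A y * k (y⁻¹ * z) ∂μ) ^ p := ENNReal.mul_rpow_of_nonneg _ _ hp0.le
    _ ≤ _ := by
      rw [mul_assoc]
      gcongr
      -- Replacing `y` by `yv` moves the arguments of both factors within translates of `V`: the
      -- first by `v⁻¹`, the second by a conjugate of `v`. Both factors are dominated by local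
      -- suprema at `yv`.
      refine lintegral_rpow_le_of_translate_le hV hp0 hp1 fun y v hv => ?_
      rw [ENNReal.mul_rpow_of_nonneg _ _ hp0.le]
      gcongr
      · simpa using le_localSup (fun x => A x ^ p) (y * v) (hV.inv_mem v hv)
      · have h1 := hV.conj_mem (y⁻¹ * z)⁻¹ v hv
        have h2 := le_localSup (fun x => k x ^ p) ((y * v)⁻¹ * z) h1
        simpa [mul_assoc] using h2

end Discretization

/-! ### The voice transform, totality of orbits and Schur's lemma. -/

section Voice

variable {G : Type*} [Group G] [TopologicalSpace G]
variable {H : Type*} [NormedAddCommGroup H] [InnerProductSpace ℂ H] [CompleteSpace H]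
  {π : G →* unitary (H →L[ℂ] H)}

theorem inner_rep_rep (x : G) (a b : H) :
    inner ℂ ((π x : H →L[ℂ] H) a) ((π x : H →L[ℂ] H) b) = inner ℂ a b :=
  ContinuousLinearMap.inner_map_map_of_mem_unitary (π x).2 a b

theorem norm_rep (x : G) (a : H) : ‖(π x : H →L[ℂ] H) a‖ = ‖a‖ :=
  ContinuousLinearMap.norm_map_of_mem_unitary (π x).2 a

theorem rep_mul (x y : G) (a : H) :
    (π (x * y) : H →L[ℂ] H) a = (π x : H →L[ℂ] H) ((π y : H →L[ℂ] H) a) := by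
  rw [map_mul]; rfl

theorem rep_one (a : H) : (π (1 : G) : H →L[ℂ] H) a = a := by
  rw [map_one]; rfl

theorem inner_rep_left (x : G) (a b : H) :
    inner ℂ ((π x : H →L[ℂ] H) a) b = inner ℂ a ((π x⁻¹ : H →L[ℂ] H) b) := by
  rw [← inner_rep_rep (π := π) x⁻¹, ← rep_mul, inv_mul_cancel, rep_one]

theorem voice_rep (g f : H) (z x : G) :
    voice π g ((π z : H →L[ℂ] H) f) x = voice π g f (z⁻¹ * x) := by
  simp only [voice]
  rw [← inner_rep_rep (π := π) z⁻¹, ← rep_mul, ← rep_mul, inv_mul_cancel, rep_one]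

theorem voice_swap (g f : H) (x : G) : voice π f g x = starRingEnd ℂ (voice π g f x⁻¹) := by
  simp only [voice]
  rw [inner_rep_left, inner_conj_symm]

theorem enorm_voice_swap (g f : H) (x : G) : ‖voice π f g x‖ₑ = ‖voice π g f x⁻¹‖ₑ := by
  rw [voice_swap, ← ofReal_norm, RCLike.norm_conj, ofReal_norm]

theorem norm_voice_le (g f : H) (x : G) : ‖voice π g f x‖ ≤ ‖g‖ * ‖f‖ := by
  refine (norm_inner_le_norm _ _).trans ?_
  rw [norm_rep]

theorem voice_add (g a b : H) : voice π g (a + b) = voice π g a + voice π g b := by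
  ext x; simp [voice]

theorem voice_sub (g a b : H) (x : G) :
    voice π g (a - b) x = voice π g a x - voice π g b x := by
  simp [voice]

theorem voice_smul (g a : H) (c : ℂ) : voice π g (c • a) = c • voice π g a := by
  ext x; simp [voice]

theorem voice_zero_right (g : H) : voice π g 0 = 0 := by
  ext x; simp [voice]

theorem IsIrreducibleUnitaryRep.continuous_voice (hπ : IsIrreducibleUnitaryRep π) (g f : H) :
    Continuous (voice π g f) := (hπ.continuous g).inner continuous_const

/-- The orbit of a nonzero vector is total. -/
theorem IsIrreducibleUnitaryRep.exists_inner_ne_zero (hπ : IsIrreducibleUnitaryRep π) {a b : H}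
    (ha : a ≠ 0) (hb : b ≠ 0) : ∃ z : G, inner ℂ ((π z : H →L[ℂ] H) a) b ≠ 0 := by
  by_contra! hcon
  -- The orthogonal complement of the orbit is closed and invariant. It contains `b ≠ 0` but not
  -- `a`, contradicting irreducibility.
  let S : Submodule ℂ H := ⨅ z : G, (innerSL ℂ ((π z : H →L[ℂ] H) a)).ker
  have hmem : ∀ h, h ∈ S ↔ ∀ z : G, inner ℂ ((π z : H →L[ℂ] H) a) h = 0 := by
    intro h; simp [S, Submodule.mem_iInf]
  have hclosed : IsClosed (S : Set H) := by
    have : (S : Set H) = ⋂ z : G, {h | inner ℂ ((π z : H →L[ℂ] H) a) h = 0} := by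
      ext h; simpa using hmem h
    rw [this]
    exact isClosed_iInter fun z => isClosed_eq (by fun_prop) continuous_const
  have hinv : ∀ x : G, ∀ h ∈ S, (π x : H →L[ℂ] H) h ∈ S := by
    intro x h hh
    rw [hmem] at hh ⊢
    intro z
    have := hh (x⁻¹ * z)
    rwa [rep_mul, inner_rep_left, inv_inv] at this
  rcases hπ.irreducible S hclosed hinv with h | h
  · have : b ∈ S := (hmem b).2 hcon
    rw [h] at this
    exact hb (by simpa using this)
  · have : a ∈ S := h ▸ Submodule.mem_top
    have := (hmem a).1 this 1
    rw [rep_one] at this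
    exact ha (inner_self_eq_zero.1 this)

/-- Schur's lemma for bounded self-adjoint operators. -/
theorem IsIrreducibleUnitaryRep.eq_algebraMap_of_commute (hπ : IsIrreducibleUnitaryRep π)
    {T : H →L[ℂ] H} (hT : IsSelfAdjoint T) (hc : ∀ x, Commute T (π x : H →L[ℂ] H)) :
    ∃ r : ℝ, T = algebraMap ℝ (H →L[ℂ] H) r := by
  have := hπ.nontrivial
  obtain ⟨r, hr⟩ := ContinuousFunctionalCalculus.spectrum_nonempty (R := ℝ) T hT
  refine ⟨r, CFC.eq_algebraMap_of_spectrum_subset_singleton T r ?_⟩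
  intro s hs
  by_contra hsr
  have hδ : 0 < |r - s| / 2 := by
    have : 0 < |r - s| := abs_pos.2 (sub_ne_zero.2 fun h => hsr h.symm)
    positivity
  -- If the spectrum had two points `r` and `s`, tent functions around them with disjoint supports
  -- would give two nonzero operators with product zero. The kernel of the first is then a proper
  -- nonzero closed invariant subspace.
  let bump : ℝ → ℝ → ℝ := fun a t => max 0 (|r - s| / 2 - |t - a|)
  have hcont : ∀ a, Continuous (bump a) := fun a => by fun_prop
  have hne : ∀ a ∈ spectrum ℝ T, cfc (bump a) T ≠ 0 := by
    intro a ha h0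
    have h1 : bump a a ∈ spectrum ℝ (cfc (bump a) T) := by
      rw [cfc_map_spectrum (R := ℝ) (bump a) T hT (hcont a).continuousOn]
      exact ⟨a, ha, rfl⟩
    rw [h0, spectrum.zero_eq] at h1
    have : bump a a = |r - s| / 2 := by simp [bump, hδ.le]
    rw [this] at h1
    exact hδ.ne' h1
  have hmul : cfc (bump r) T * cfc (bump s) T = 0 := by
    rw [← cfc_mul (bump r) (bump s) T (hcont r).continuousOn (hcont s).continuousOn]
    have : (fun x => bump r x * bump s x) = fun _ => 0 := by
      ext t
      rcases le_total (|r - s| / 2) |t - r| with h | h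
      · simp [bump, h]
      · have : |r - s| / 2 ≤ |t - s| := by
          have := abs_sub_le r t s
          rw [abs_sub_comm r t] at this
          linarith
        simp [bump, this]
    rw [this, cfc_const_zero]
  let S : Submodule ℂ H := (cfc (bump r) T).ker
  have hinv : ∀ x : G, ∀ h ∈ S, (π x : H →L[ℂ] H) h ∈ S := by
    intro x h hh
    have h1 : Commute (cfc (bump r) T) (π x : H →L[ℂ] H) := hT.commute_cfc (hc x) _
    have h2 := congrArg (fun A : H →L[ℂ] H => A h) h1.eq
    simp only [mul_apply_eq_comp] at h2
    simp only [S, LinearMap.mem_ker, ContinuousLinearMap.coe_coe] at hh ⊢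
    rw [h2, hh, map_zero]
  rcases hπ.irreducible S (ContinuousLinearMap.isClosed_ker _) hinv with h | h
  · refine hne s hs (ContinuousLinearMap.ext fun v => ?_)
    have h1 : cfc (bump s) T v ∈ S := by
      have := congrArg (fun A : H →L[ℂ] H => A v) hmul
      simpa [S] using this
    rw [h] at h1
    simpa using h1
  · refine hne r hr (ContinuousLinearMap.ext fun v => ?_)
    have h1 : v ∈ S := h ▸ Submodule.mem_top
    simpa [S] using h1

end Voice

/-! ### The voice transform as a closed operator into `L²`. -/

section Orthogonality

variable {G : Type*} [Group G] [TopologicalSpace G] [IsTopologicalGroup G]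
  [MeasurableSpace G] [BorelSpace G]
variable {H : Type*} [NormedAddCommGroup H] [InnerProductSpace ℂ H] [CompleteSpace H]
  {π : G →* unitary (H →L[ℂ] H)} {μ : Measure G}

theorem memLp_voice_rep [μ.IsMulLeftInvariant] {g h : H} (hh : MemLp (voice π g h) 2 μ) (z : G) :
    MemLp (voice π g ((π z : H →L[ℂ] H) h)) 2 μ := by
  have : voice π g ((π z : H →L[ℂ] H) h) = voice π g h ∘ (z⁻¹ * ·) := by
    ext x; exact voice_rep g h z x
  rw [this]
  exact hh.comp_measurePreserving (measurePreserving_mul_left μ z⁻¹)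

theorem memLp_voice_swap [μ.IsInvInvariant] {g h : H} (hh : MemLp (voice π g h) 2 μ) :
    MemLp (voice π h g) 2 μ := by
  have : voice π h g = star (voice π g h ∘ Inv.inv) := by
    ext x; exact voice_swap g h x
  rw [this]
  exact (hh.comp_measurePreserving (Measure.measurePreserving_inv μ)).star

/-- The graph of the voice transform `h ↦ V_g h`, as an operator into `L²`. -/
def voiceGraph (π : G →* unitary (H →L[ℂ] H)) (μ : Measure G) (g : H) :
    Submodule ℂ (WithLp 2 (H × Lp ℂ 2 μ)) where
  carrier := {z | z.snd =ᵐ[μ] voice π g z.fst}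
  add_mem' {a b} ha hb := by
    change (a + b).snd =ᵐ[μ] voice π g (a + b).fst
    filter_upwards [ha, hb, Lp.coeFn_add a.snd b.snd] with x h1 h2 h3
    rw [WithLp.add_snd, WithLp.add_fst, h3, voice_add, Pi.add_apply, Pi.add_apply, h1, h2]
  zero_mem' := by
    change (0 : Lp ℂ 2 μ) =ᵐ[μ] voice π g 0
    rw [voice_zero_right]
    exact Lp.coeFn_zero _ _ _
  smul_mem' c a ha := by
    change (c • a).snd =ᵐ[μ] voice π g (c • a).fst
    filter_upwards [ha, Lp.coeFn_smul c a.snd] with x h1 h2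
    rw [WithLp.smul_snd, WithLp.smul_fst, h2, voice_smul, Pi.smul_apply, Pi.smul_apply, h1]

/-- A convergent sequence in `L²` has an almost everywhere convergent subsequence, while `h ↦ V_g
h(x)` is continuous for every `x`; the two limits agree. -/
theorem isClosed_voiceGraph (μ : Measure G) (g : H) :
    IsClosed (voiceGraph π μ g : Set (WithLp 2 (H × Lp ℂ 2 μ))) := by
  refine IsSeqClosed.isClosed fun u z hu hz => ?_
  have h1 : Filter.Tendsto (fun n => (u n).fst) Filter.atTop (𝓝 z.fst) :=
    ((WithLp.fstL 2 ℂ H (Lp ℂ 2 μ)).continuous.tendsto z).comp hz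
  have h2 : Filter.Tendsto (fun n => (u n).snd) Filter.atTop (𝓝 z.snd) :=
    ((WithLp.sndL 2 ℂ H (Lp ℂ 2 μ)).continuous.tendsto z).comp hz
  obtain ⟨ns, hns, hlim⟩ := (tendstoInMeasure_of_tendsto_Lp h2).exists_seq_tendsto_ae
  change z.snd =ᵐ[μ] voice π g z.fst
  have h3 : ∀ᵐ x ∂μ, ∀ n, (u n).snd x = voice π g (u n).fst x := ae_all_iff.2 fun n => hu n
  filter_upwards [hlim, h3] with x hx h3
  refine tendsto_nhds_unique hx ?_
  simp only [h3]
  exact tendsto_const_nhds.inner (h1.comp hns.tendsto_atTop)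

theorem mk_mem_voiceGraph {g h : H}
    (hh : MemLp (voice π g h) 2 μ) :
    WithLp.toLp 2 (h, hh.toLp (voice π g h)) ∈ voiceGraph π μ g := hh.coeFn_toLp

theorem memLp_of_mem_voiceGraph {g : H}
    {z : WithLp 2 (H × Lp ℂ 2 μ)} (hz : z ∈ voiceGraph π μ g) : MemLp (voice π g z.fst) 2 μ :=
  (memLp_congr_ae hz).1 (Lp.memLp z.snd)

theorem inner_of_mem_voiceGraph {g : H}
    {y z : WithLp 2 (H × Lp ℂ 2 μ)} (hy : y ∈ voiceGraph π μ g) (hz : z ∈ voiceGraph π μ g) :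
    inner ℂ y z = inner ℂ y.fst z.fst +
      ∫ x, inner ℂ (voice π g y.fst x) (voice π g z.fst x) ∂μ := by
  rw [WithLp.prod_inner_apply, L2.inner_def]
  congr 1
  refine integral_congr_ae ?_
  filter_upwards [hy, hz] with x h1 h2
  change inner ℂ (y.snd x) (z.snd x) = _
  rw [h1, h2]

/-- If one voice transform `V_g f` with `f ≠ 0` is in `L²`, then `h ↦ V_g h` is a multiple of an
isometry into `L²`. -/
theorem IsIrreducibleUnitaryRep.exists_integral_inner_voice_eq (hπ : IsIrreducibleUnitaryRep π)
    [μ.IsMulLeftInvariant] {g f : H} (hf : f ≠ 0) (hfg : MemLp (voice π g f) 2 μ) :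
    ∃ c : ℝ, ∀ h, MemLp (voice π g h) 2 μ ∧ ∀ h',
      ∫ x, inner ℂ (voice π g h x) (voice π g h' x) ∂μ = c * inner ℂ h h' := by
  let K := voiceGraph π μ g
  have : CompleteSpace K := (isClosed_voiceGraph μ g).completeSpace_coe
  let ι : H →L[ℂ] WithLp 2 (H × Lp ℂ 2 μ) :=
    ((WithLp.prodContinuousLinearEquiv 2 ℂ H (Lp ℂ 2 μ)).symm :
      H × Lp ℂ 2 μ →L[ℂ] WithLp 2 (H × Lp ℂ 2 μ)) ∘L ContinuousLinearMap.inl ℂ H (Lp ℂ 2 μ)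
  have hι : ∀ h z, inner ℂ (ι h) z = inner ℂ h z.fst := by
    intro h z
    rw [WithLp.prod_inner_apply]
    change inner ℂ h z.fst + inner ℂ (0 : Lp ℂ 2 μ) z.snd = _
    rw [inner_zero_left, add_zero]
  have hι' : ∀ h z, inner ℂ z (ι h) = inner ℂ z.fst h := by
    intro h z
    rw [← inner_conj_symm, hι, inner_conj_symm]
  -- Formally `T = (1 + V_g^* V_g)⁻¹`, obtained as the compression to `H` of the projection onto the
  -- closed graph. This avoids unbounded operators and any prior knowledge that the domain is dense.
  let T : H →L[ℂ] H := WithLp.fstL 2 ℂ H (Lp ℂ 2 μ) ∘L K.starProjection ∘L ι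
  have hTapp : ∀ h, T h = (K.starProjection (ι h)).fst := fun h => rfl
  have hPK : ∀ h, K.starProjection (ι h) ∈ K := fun h => K.starProjection_apply_mem _
  have hPi : ∀ h, ∀ z ∈ K, inner ℂ (K.starProjection (ι h)) z = inner ℂ h z.fst := by
    intro h z hz
    rw [K.inner_starProjection_left_eq_right, K.starProjection_eq_self_iff.2 hz, hι]
  have hTself : IsSelfAdjoint T := by
    rw [ContinuousLinearMap.isSelfAdjoint_iff_isSymmetric]
    intro a b
    change inner ℂ (T a) b = inner ℂ a (T b)
    rw [hTapp, hTapp, ← hι', K.inner_starProjection_left_eq_right, hι]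
  -- The unitary `π(x)` paired with left translation on `L²` preserves the graph, hence commutes
  -- with the projection.
  have hTcomm : ∀ x, Commute T (π x : H →L[ℂ] H) := by
    intro x
    refine ContinuousLinearMap.ext fun h => ?_
    change T ((π x : H →L[ℂ] H) h) = (π x : H →L[ℂ] H) (T h)
    have hmem := mk_mem_voiceGraph (memLp_voice_rep (memLp_of_mem_voiceGraph (hPK h)) x)
    rw [hTapp, Submodule.eq_starProjection_of_mem_of_inner_eq_zero hmem]
    · rfl
    intro z hz
    have hz' := mk_mem_voiceGraph (memLp_voice_rep (memLp_of_mem_voiceGraph hz) x⁻¹)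
    have h1 := hPi h _ hz'
    rw [inner_of_mem_voiceGraph (hPK h) hz'] at h1
    rw [inner_sub_left, sub_eq_zero, hι, inner_rep_left, inner_of_mem_voiceGraph hmem hz]
    refine h1.symm.trans ?_
    change inner ℂ _ ((π x⁻¹ : H →L[ℂ] H) z.fst) +
        ∫ y, inner ℂ (voice π g _ y) (voice π g ((π x⁻¹ : H →L[ℂ] H) z.fst) y) ∂μ =
      inner ℂ ((π x : H →L[ℂ] H) _) z.fst +
        ∫ y, inner ℂ (voice π g ((π x : H →L[ℂ] H) _) y) (voice π g z.fst y) ∂μ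
    rw [inner_rep_left]
    congr 1
    simp only [voice_rep, inv_inv]
    rw [← integral_mul_left_eq_self _ x⁻¹]
    simp only [mul_inv_cancel_left]
  obtain ⟨r, hr⟩ := hπ.eq_algebraMap_of_commute hTself hTcomm
  have hTr : ∀ h, T h = (r : ℂ) • h := by
    intro h
    rw [hr, Algebra.algebraMap_eq_smul_one]
    simp
  have hr0 : r ≠ 0 := by
    rintro rfl
    have hz := mk_mem_voiceGraph hfg
    have h1 := hPi f _ hz
    rw [inner_of_mem_voiceGraph (hPK f) hz, ← hTapp, hTr] at h1
    simp only [Complex.ofReal_zero, zero_smul, voice_zero_right, Pi.zero_apply, inner_zero_left,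
      integral_zero, add_zero] at h1
    exact hf (inner_self_eq_zero.1 h1.symm)
  have hr0' : (r : ℂ) ≠ 0 := by exact_mod_cast hr0
  have hfst : ∀ h, (K.starProjection (ι ((r : ℂ)⁻¹ • h))).fst = h := by
    intro h
    rw [← hTapp, hTr, smul_inv_smul₀ hr0']
  have hall : ∀ h, MemLp (voice π g h) 2 μ := by
    intro h
    have h1 := memLp_of_mem_voiceGraph (hPK ((r : ℂ)⁻¹ • h))
    rwa [hfst] at h1
  -- The projection of `(r⁻¹ h, 0)` is `(h, V_g h)`. Pairing it with `(h', V_g h')` gives `⟨h, h'⟩`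
  -- plus the integral on one side and `r⁻¹ ⟨h, h'⟩` on the other.
  refine ⟨r⁻¹ - 1, fun h => ⟨hall h, fun h' => ?_⟩⟩
  have hz := mk_mem_voiceGraph (hall h')
  have h1 := hPi ((r : ℂ)⁻¹ • h) _ hz
  rw [inner_of_mem_voiceGraph (hPK _) hz, hfst] at h1
  rw [inner_smul_left] at h1
  simp only [map_inv₀, Complex.conj_ofReal] at h1
  change inner ℂ h h' + ∫ x, inner ℂ (voice π g h x) (voice π g h' x) ∂μ =
    (r : ℂ)⁻¹ * inner ℂ h h' at h1
  push_cast
  linear_combination h1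

end Orthogonality

/-! ### Orthogonality relations and the reproducing formula. -/

section Reproducing

variable {G : Type*} [Group G] [TopologicalSpace G] [IsTopologicalGroup G]
  [MeasurableSpace G] [BorelSpace G]
variable {H : Type*} [NormedAddCommGroup H] [InnerProductSpace ℂ H] [CompleteSpace H]
  {π : G →* unitary (H →L[ℂ] H)} {μ : Measure G}

/-- The voice transforms are square integrable and satisfy the orthogonality relations with the
constant `κ ≠ 0`. -/
structure IsOrthogonality (π : G →* unitary (H →L[ℂ] H)) (μ : Measure G) (κ : ℝ) : Prop where
  ne_zero : κ ≠ 0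
  memLp : ∀ g f, MemLp (voice π g f) 2 μ
  integral_inner : ∀ g f g' f', ∫ x, inner ℂ (voice π g f x) (voice π g' f' x) ∂μ =
    κ * (inner ℂ f f' * inner ℂ g' g)

theorem inner_voice_swap (g g' f f' : H) (x : G) :
    inner ℂ (voice π g f x⁻¹) (voice π g' f' x⁻¹) =
      inner ℂ (voice π f' g' x) (voice π f g x) := by
  rw [voice_swap g' f', voice_swap g f]
  simp [mul_comm]

theorem integral_inner_voice_swap [μ.IsInvInvariant] (g g' f f' : H) :
    ∫ x, inner ℂ (voice π g f x) (voice π g' f' x) ∂μ =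
      ∫ x, inner ℂ (voice π f' g' x) (voice π f g x) ∂μ := by
  rw [← integral_inv_eq_self]
  simp only [inner_voice_swap]

/-- The orthogonality relations on a unimodular group, given one nonzero square integrable
coefficient. -/
theorem IsIrreducibleUnitaryRep.exists_isOrthogonality (hπ : IsIrreducibleUnitaryRep π)
    [μ.IsMulLeftInvariant] [μ.IsInvInvariant] [μ.IsOpenPosMeasure] {g f : H} (hg : g ≠ 0)
    (hf : f ≠ 0) (hfg : MemLp (voice π g f) 2 μ) : ∃ κ : ℝ, IsOrthogonality π μ κ := by
  obtain ⟨c₀, hc₀⟩ := hπ.exists_integral_inner_voice_eq hf hfg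
  -- For the window `g` every transform is in `L²`. Inversion exchanges window and argument, so each
  -- window `h` has the nonzero vector `g` with square integrable transform, and the isometry
  -- statement applies to it.
  have hex : ∀ h, ∃ c : ℝ, ∀ a, MemLp (voice π h a) 2 μ ∧ ∀ b,
      ∫ x, inner ℂ (voice π h a x) (voice π h b x) ∂μ = c * inner ℂ a b := fun h =>
    hπ.exists_integral_inner_voice_eq hg (memLp_voice_swap (hc₀ h).1)
  choose c hc using hex
  have hmem : ∀ a b, MemLp (voice π a b) 2 μ := fun a b => (hc a b).1
  have hsym : ∀ a b : H, (c a : ℂ) * inner ℂ b b = c b * inner ℂ a a := by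
    intro a b
    rw [← (hc a b).2, ← (hc b a).2, integral_inner_voice_swap]
  -- By `hsym`, the ratio of `c a` to `‖a‖²` is independent of `a ≠ 0`.
  set κ : ℝ := c g / ‖g‖ ^ 2 with hκ
  have hgn : (‖g‖ : ℂ) ≠ 0 := by exact_mod_cast norm_ne_zero_iff.2 hg
  have hcκ : ∀ a : H, (c a : ℂ) = κ * inner ℂ a a := by
    intro a
    have h1 := hsym a g
    simp only [inner_self_eq_norm_sq_to_K] at h1 ⊢
    rw [hκ]
    push_cast
    field_simp
    exact h1
  refine ⟨κ, ?_, hmem, fun a b a' b' => ?_⟩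
  · intro h0
    have h1 : ∫ x, ‖voice π g g x‖ ^ 2 ∂μ = 0 := by
      have h2 := (hc g g).2 g
      rw [hcκ g, h0] at h2
      simp only [inner_self_eq_norm_sq_to_K, Complex.ofReal_zero, zero_mul] at h2
      have h4 : ((∫ x, ‖voice π g g x‖ ^ 2 ∂μ : ℝ) : ℂ) = 0 := by
        rw [← integral_complex_ofReal]
        push_cast
        exact h2
      exact_mod_cast h4
    rw [integral_eq_zero_iff_of_nonneg (fun x => by positivity)
      ((hmem g g).integrable_norm_pow (by simp))] at h1
    have hcont : Continuous fun x => ‖voice π g g x‖ ^ 2 :=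
      (hπ.continuous_voice g g).norm.pow 2
    have h3 := congrFun ((hcont.ae_eq_iff_eq μ continuous_const).1 h1) 1
    simp only [voice, rep_one] at h3
    exact hg (inner_self_eq_zero.1 (norm_eq_zero.1 ((pow_eq_zero_iff two_ne_zero).1 h3)))
  · let Φ : H → H → Lp ℂ 2 μ := fun a b => (hmem a b).toLp (voice π a b)
    have hΦadd : ∀ a b b', Φ a (b + b') = Φ a b + Φ a b' := by
      intro a b b'
      rw [← MemLp.toLp_add]
      exact MemLp.toLp_congr _ _ (by rw [voice_add])
    have hΦsmul : ∀ a (z : ℂ) b, Φ a (z • b) = z • Φ a b := by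
      intro a z b
      rw [← MemLp.toLp_const_smul]
      exact MemLp.toLp_congr _ _ (by rw [voice_smul])
    have hΦ : ∀ a b a' b', inner ℂ (Φ a b) (Φ a' b') =
        ∫ x, inner ℂ (voice π a b x) (voice π a' b' x) ∂μ := by
      intro a b a' b'
      rw [L2.inner_def]
      refine integral_congr_ae ?_
      filter_upwards [(hmem a b).coeFn_toLp, (hmem a' b').coeFn_toLp] with x h1 h2
      rw [h1, h2]
    -- Exchanging windows and arguments settles the case of equal arguments; polarization with `b +
    -- b'` and `b + i b'` extends it to distinct ones.
    have hdiag : ∀ d, inner ℂ (Φ a d) (Φ a' d) = κ * (inner ℂ d d * inner ℂ a' a) := by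
      intro d
      rw [hΦ, integral_inner_voice_swap, (hc d a').2, hcκ]
      ring
    rw [← hΦ]
    have h1 := hdiag (b + b')
    have h2 := hdiag (b + Complex.I • b')
    have hI := Complex.I_ne_zero
    simp only [hΦadd, hΦsmul, inner_add_left, inner_add_right, inner_smul_left, inner_smul_right,
      hdiag, Complex.conj_I] at h1 h2
    have h3 : (2 * Complex.I) * (inner ℂ (Φ a b) (Φ a' b') -
        κ * (inner ℂ b b' * inner ℂ a' a)) = 0 := by
      linear_combination h2 + Complex.I * h1
    exact sub_eq_zero.1 ((mul_eq_zero.1 h3).resolve_left (by simp))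

variable {κ : ℝ}

/-- The reproducing formula `V_g f * V_h k = κ ⟨k, g⟩ V_h f`. -/
theorem IsOrthogonality.integral_voice_mul_voice (hκ : IsOrthogonality π μ κ) (g f h k : H)
    (x : G) : ∫ y, voice π g f y * voice π h k (y⁻¹ * x) ∂μ =
      κ * inner ℂ g k * voice π h f x := by
  have h1 : ∀ y, voice π g f y * voice π h k (y⁻¹ * x) =
      inner ℂ (voice π k ((π x : H →L[ℂ] H) h) y) (voice π g f y) := by
    intro y
    have h2 : voice π h k (y⁻¹ * x) =
        starRingEnd ℂ (voice π k ((π x : H →L[ℂ] H) h) y) := by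
      simp only [voice]
      rw [inner_conj_symm, rep_mul, inner_rep_left, inv_inv]
    rw [h2]
    rfl
  simp only [h1, hκ.integral_inner]
  simp only [voice]
  ring

/-- The factor `⟨k, g⟩` in the reproducing formula may vanish. Irreducibility gives `z` for which
`π(z)k` is not orthogonal to `g`, and this replacement only left-translates `V_h k`. -/
theorem IsOrthogonality.exists_enorm_voice_le (hκ : IsOrthogonality π μ κ)
    (hπ : IsIrreducibleUnitaryRep π) {g k : H} (hg : g ≠ 0) (hk : k ≠ 0) (f h : H) :
    ∃ c : ℝ≥0∞, c ≠ ∞ ∧ ∃ z : G, ∀ x, ‖voice π h f x‖ₑ ≤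
      c * ∫⁻ y, ‖voice π g f y‖ₑ * ‖voice π h k (z⁻¹ * (y⁻¹ * x))‖ₑ ∂μ := by
  obtain ⟨z, hz⟩ := hπ.exists_inner_ne_zero hk hg
  have hz' : inner ℂ g ((π z : H →L[ℂ] H) k) ≠ 0 := fun h0 => hz (by
    rw [← inner_conj_symm, h0, map_zero])
  set d : ℂ := κ * inner ℂ g ((π z : H →L[ℂ] H) k)
  have hd : d ≠ 0 := mul_ne_zero (by exact_mod_cast hκ.ne_zero) hz'
  refine ⟨‖d⁻¹‖ₑ, enorm_ne_top, z, fun x => ?_⟩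
  have h1 := hκ.integral_voice_mul_voice g f h ((π z : H →L[ℂ] H) k) x
  have h2 : voice π h f x = d⁻¹ *
      ∫ y, voice π g f y * voice π h ((π z : H →L[ℂ] H) k) (y⁻¹ * x) ∂μ := by
    rw [h1, inv_mul_cancel_left₀ hd]
  rw [h2, enorm_mul]
  gcongr
  refine (enorm_integral_le_lintegral_enorm _).trans (le_of_eq ?_)
  simp only [enorm_mul, voice_rep]

end Reproducing

/-! ### Amalgam membership of voice transforms. -/

section VoiceAmalgam

variable {G : Type*} [Group G] [TopologicalSpace G] [IsTopologicalGroup G] [LocallyCompactSpace G]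
  [T2Space G] [MeasurableSpace G] [BorelSpace G]
variable {H : Type*} [NormedAddCommGroup H] [InnerProductSpace ℂ H] [CompleteSpace H]
  {π : G →* unitary (H →L[ℂ] H)} {μ : Measure G} {κ : ℝ} {V : Set G} {m : G → ℝ≥0∞}

theorem IsIrreducibleUnitaryRep.continuous_enorm_voice (hπ : IsIrreducibleUnitaryRep π)
    (g f : H) : Continuous fun x => ‖voice π g f x‖ₑ := (hπ.continuous_voice g f).enorm

theorem IsIrreducibleUnitaryRep.lowerSemicontinuous_voice_rpow (hπ : IsIrreducibleUnitaryRep π)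
    (g f : H) (p : ℝ) : LowerSemicontinuous fun x => ‖voice π g f x‖ₑ ^ p :=
  (ENNReal.continuous_rpow_const.comp (hπ.continuous_enorm_voice g f)).lowerSemicontinuous

theorem IsOrthogonality.isAmalgam_voice (hκ : IsOrthogonality π μ κ)
    (hπ : IsIrreducibleUnitaryRep π) (hV : IsInvariantNhd V) [μ.IsHaarMeasure]
    [μ.IsMulRightInvariant] (hm : IsSymmWeight m) {p : ℝ} (hp0 : 0 < p) (hp1 : p ≤ 1)
    {f g h k : H} (hg : g ≠ 0) (hk : k ≠ 0) (hfg : IsAmalgam μ m fun x => ‖voice π g f x‖ₑ ^ p)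
    (hhk : IsAmalgam μ m fun x => ‖voice π h k x‖ₑ ^ p) :
    IsAmalgam μ m fun x => ‖voice π h f x‖ₑ ^ p := by
  obtain ⟨c, hc, z, hz⟩ := hκ.exists_enorm_voice_le hπ hg hk f h
  exact hfg.of_le_convolution_rpow hV hm hp0 hp1 (hhk.leftTranslate hm z)
    (hπ.lowerSemicontinuous_voice_rpow h f p) hc hz

/-- One factor of the convolution needs only weighted integrability: local control is inherited from
the other factor. -/
theorem IsOrthogonality.isAmalgam_voice_of_lintegral (hκ : IsOrthogonality π μ κ)
    (hπ : IsIrreducibleUnitaryRep π) (hV : IsInvariantNhd V) [μ.IsHaarMeasure]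
    [μ.IsMulRightInvariant] (hm : IsSymmWeight m)
    {f g h k : H} (hg : g ≠ 0) (hk : k ≠ 0) (hfg : ∫⁻ x, ‖voice π g f x‖ₑ * m x ∂μ < ∞)
    (hhk : IsAmalgam μ m fun x => ‖voice π h k x‖ₑ) :
    IsAmalgam μ m fun x => ‖voice π h f x‖ₑ := by
  obtain ⟨c, hc, z, hz⟩ := hκ.exists_enorm_voice_le hπ hg hk f h
  exact IsAmalgam.of_le_convolution hV hm (hπ.continuous_enorm_voice g f).lowerSemicontinuous hfg
    (hhk.leftTranslate hm z) (hπ.continuous_enorm_voice h f).lowerSemicontinuous hc hz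

theorem isAmalgam_voice_swap (hV : IsInvariantNhd V) [μ.IsMulRightInvariant] [μ.IsInvInvariant]
    (hm : IsSymmWeight m) {p : ℝ} {f g : H} (h : IsAmalgam μ m fun x => ‖voice π g f x‖ₑ ^ p) :
    IsAmalgam μ m fun x => ‖voice π f g x‖ₑ ^ p := by
  simp only [enorm_voice_swap g f]
  exact h.comp_inv hV hm

end VoiceAmalgam

/-! ### Control functions versus local suprema. -/

section Control

variable {G : Type*} [Group G] [TopologicalSpace G] [IsTopologicalGroup G] [LocallyCompactSpace G]
  [T2Space G] [MeasurableSpace G] [BorelSpace G] {μ : Measure G} {Q : Set G} {F : G → ℂ}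

theorem control_le_iff {x : G} {c : ℝ≥0∞} :
    control μ Q F x ≤ c ↔ ∀ᵐ y ∂μ, x⁻¹ * y ∈ Q → ‖F y‖ₑ ≤ c := by
  have hmem : ∀ y, y ∈ x • Q ↔ x⁻¹ * y ∈ Q := fun y => Set.mem_smul_set_iff_inv_smul_mem
  constructor
  · intro h
    filter_upwards [ae_le_eLpNormEssSup (f := (x • Q).indicator F) (μ := μ)] with y hy hyQ
    rw [Set.indicator_of_mem ((hmem y).2 hyQ)] at hy
    rw [control, eLpNorm_exponent_top] at h
    exact hy.trans h
  · intro h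
    rw [control, eLpNorm_exponent_top]
    refine essSup_le_of_ae_le _ ?_
    filter_upwards [h] with y hy
    by_cases hyQ : y ∈ x • Q
    · rw [Set.indicator_of_mem hyQ]; exact hy ((hmem y).1 hyQ)
    · rw [Set.indicator_of_notMem hyQ]; simp

theorem ae_enorm_le_control (μ : Measure G) (Q : Set G) (F : G → ℂ) (x : G) :
    ∀ᵐ y ∂μ, x⁻¹ * y ∈ Q → ‖F y‖ₑ ≤ control μ Q F x := control_le_iff.1 le_rfl

theorem control_le_localSup (x : G) : control μ Q F x ≤ localSup Q (fun y => ‖F y‖ₑ) x :=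
  control_le_iff.2 (.of_forall fun y hy => by
    simpa using le_localSup (fun y => ‖F y‖ₑ) x hy)

/-- Lower semicontinuity makes a value above the essential supremum persist on a nonempty open set,
which has positive measure. -/
theorem localSup_le_control [μ.IsOpenPosMeasure] {U : Set G} (hU : IsOpen U) (hUQ : U ⊆ Q)
    (hF : LowerSemicontinuous fun y => ‖F y‖ₑ) (x : G) :
    localSup U (fun y => ‖F y‖ₑ) x ≤ control μ Q F x := by
  refine localSup_le fun u hu => ?_
  by_contra! hlt
  have hopen : IsOpen (x • U ∩ {y | control μ Q F x < ‖F y‖ₑ}) :=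
    (hU.smul x).inter (hF.isOpen_preimage (control μ Q F x))
  refine (hopen.measure_pos μ ⟨x * u, Set.smul_mem_smul_set hu, hlt⟩).ne' ?_
  have h := ae_enorm_le_control μ Q F x
  rw [ae_iff] at h
  refine measure_mono_null ?_ h
  rintro y ⟨⟨v, hv, rfl⟩, hy⟩
  simp only [Set.mem_ofPred_eq, not_forall, not_le]
  exact ⟨by simpa using hUQ hv, hy⟩

theorem control_mono {Q' : Set G} {x x' : G} (h : x • Q ⊆ x' • Q') :
    control μ Q F x ≤ control μ Q' F x' := by
  rw [control_le_iff]
  filter_upwards [ae_enorm_le_control μ Q' F x'] with y hy hyQ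
  exact hy (Set.mem_smul_set_iff_inv_smul_mem.1
    (h (Set.mem_smul_set_iff_inv_smul_mem.2 hyQ)))

theorem control_rpow_le_sum {B B' : Set G} {T : Finset G} (hT : B ⊆ ⋃ t ∈ T, t • B') {p : ℝ}
    (hp0 : 0 < p) (x : G) :
    control μ B F x ^ p ≤ ∑ t ∈ T, control μ B' F (x * t) ^ p := by
  rw [← ENNReal.le_rpow_inv_iff hp0, control_le_iff]
  have h : ∀ᵐ y ∂μ, ∀ t ∈ T, (x * t)⁻¹ * y ∈ B' → ‖F y‖ₑ ≤ control μ B' F (x * t) :=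
    (Filter.eventually_all_finset T).2 fun t _ => ae_enorm_le_control μ B' F (x * t)
  filter_upwards [h] with y hy hyB
  obtain ⟨t, ht, v, hv, hvy⟩ : ∃ t ∈ T, ∃ v ∈ B', t * v = x⁻¹ * y := by
    simpa [Set.mem_smul_set] using hT hyB
  have h1 : (x * t)⁻¹ * y ∈ B' := by
    have : (x * t)⁻¹ * y = v := by rw [mul_inv_rev, mul_assoc, ← hvy, inv_mul_cancel_left]
    rwa [this]
  rw [ENNReal.le_rpow_inv_iff hp0]
  exact (ENNReal.rpow_le_rpow (hy t ht h1) hp0.le).trans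
    (Finset.single_le_sum (f := fun t => control μ B' F (x * t) ^ p) (fun _ _ => zero_le) ht)

theorem control_leftTranslate [μ.IsMulLeftInvariant] (z x : G) :
    control μ Q (leftTranslate z F) x ≤ control μ Q F (z⁻¹ * x) := by
  rw [control_le_iff]
  have h := (measurePreserving_mul_left μ z⁻¹).quasiMeasurePreserving.ae
    (ae_enorm_le_control μ Q F (z⁻¹ * x))
  filter_upwards [h] with y hy hyQ
  exact hy (by simpa [mul_assoc] using hyQ)

/-- Conjugation invariance gives `xVz = xzV`, so a right translate of the function becomes a right
translate of the control function. -/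
theorem IsInvariantNhd.control_rightTranslate {V : Set G} (hV : IsInvariantNhd V)
    [μ.IsMulRightInvariant] (z x : G) :
    control μ V (rightTranslate z F) x ≤ control μ V F (x * z) := by
  rw [control_le_iff]
  have h := (measurePreserving_mul_right μ z).quasiMeasurePreserving.ae
    (ae_enorm_le_control μ V F (x * z))
  filter_upwards [h] with y hy hyV
  refine hy ?_
  simpa [mul_assoc] using hV.conj_mem z⁻¹ _ hyV

variable {p : ℝ} {m : G → ℝ≥0∞}

theorem wienerNorm_lt_top_iff (hp0 : 0 < p) :
    wienerNorm μ Q p m F < ∞ ↔ ∫⁻ x, control μ Q F x ^ p * m x ^ p ∂μ < ∞ := by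
  rw [wienerNorm, ENNReal.rpow_lt_top_iff_of_pos (by positivity)]
  simp only [ENNReal.mul_rpow_of_nonneg _ _ hp0.le]

/-- The amalgam space in terms of local suprema; it does not depend on the window. -/
theorem wienerNorm_lt_top_iff_isAmalgam [μ.IsHaarMeasure] [μ.IsMulRightInvariant]
    (hQ : IsWindow Q) (hm : IsSymmWeight m) (hp0 : 0 < p)
    (hF : LowerSemicontinuous fun y => ‖F y‖ₑ) :
    wienerNorm μ Q p m F < ∞ ↔ IsAmalgam μ (fun x => m x ^ p) fun x => ‖F x‖ₑ ^ p := by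
  rw [wienerNorm_lt_top_iff hp0]
  constructor
  · intro h
    have hlsc : LowerSemicontinuous fun x => ‖F x‖ₑ ^ p :=
      ENNReal.continuous_rpow_const.comp_lowerSemicontinuous hF
        (ENNReal.monotone_rpow_of_nonneg hp0.le)
    refine isAmalgam_of_isOpen (hm.rpow hp0) hlsc isOpen_interior
      (mem_interior_iff_mem_nhds.2 hQ.mem_nhds) (lt_of_le_of_lt (lintegral_mono fun x => ?_) h)
    rw [localSup_rpow _ _ hp0]
    gcongr
    exact localSup_le_control isOpen_interior interior_subset hF x
  · intro h
    refine lt_of_le_of_lt (lintegral_mono fun x => ?_) (h.lintegral_lt_top Q hQ.isCompact_closure)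
    rw [localSup_rpow _ _ hp0]
    gcongr
    exact control_le_localSup x

theorem memWiener_iff_isAmalgam [μ.IsHaarMeasure] [μ.IsMulRightInvariant]
    (hQ : IsWindow Q) (hm : IsSymmWeight m) (hp0 : 0 < p) (hF : Continuous F) :
    MemWiener μ Q p m F ↔ IsAmalgam μ (fun x => m x ^ p) fun x => ‖F x‖ₑ ^ p := by
  rw [← wienerNorm_lt_top_iff_isAmalgam hQ hm hp0 hF.enorm.lowerSemicontinuous]
  refine ⟨fun h => h.norm_lt_top, fun h => ⟨hF.aestronglyMeasurable, fun C hC => ?_, h⟩⟩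
  obtain ⟨c, hc⟩ := hC.exists_bound_of_continuousOn hF.continuousOn
  rw [eLpNorm_exponent_top]
  refine (eLpNormEssSup_le_of_ae_bound (C := max c 0) (.of_forall fun x => ?_)).trans_lt
    ENNReal.ofReal_lt_top
  by_cases hx : x ∈ C
  · rw [Set.indicator_of_mem hx]; exact (hc x hx).trans (le_max_left _ _)
  · rw [Set.indicator_of_notMem hx]; simp

end Control

/-! ### Operator norms of translations are comparable to the weight. -/

section OperatorNorms

variable {G : Type*} [Group G] [TopologicalSpace G] [IsTopologicalGroup G] [LocallyCompactSpace G]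
  [T2Space G] [MeasurableSpace G] [BorelSpace G] {μ : Measure G} {Q V : Set G} {p : ℝ}
  {w : G → ℝ}

theorem wienerOpNorm_le {m : G → ℝ≥0∞} {T : (G → ℂ) → G → ℂ} {c : ℝ≥0∞}
    (h : ∀ F, MemWiener μ Q p m F → wienerNorm μ Q p m (T F) ≤ c * wienerNorm μ Q p m F) :
    wienerOpNorm μ Q p m T ≤ c := sInf_le h

theorem wienerNorm_le_of_lintegral_le {m : G → ℝ≥0∞} {F F' : G → ℂ} {c : ℝ≥0∞} (hp0 : 0 < p)
    (h : ∫⁻ x, control μ Q F' x ^ p * m x ^ p ∂μ ≤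
      c * ∫⁻ x, control μ Q F x ^ p * m x ^ p ∂μ) :
    wienerNorm μ Q p m F' ≤ c ^ (1 / p) * wienerNorm μ Q p m F := by
  simp only [wienerNorm, ENNReal.mul_rpow_of_nonneg _ _ hp0.le]
  rw [← ENNReal.mul_rpow_of_nonneg _ _ (by positivity)]
  exact ENNReal.rpow_le_rpow h (by positivity)

theorem leftWeight_le [μ.IsMulLeftInvariant] (hm : IsSymmWeight (toWeight w)) (hp0 : 0 < p)
    (x : G) : leftWeight μ Q p w x ≤ toWeight w x := by
  refine max_le (hm.one_le x) (wienerOpNorm_le fun F _ => ?_)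
  have h : (toWeight w x ^ p) ^ (1 / p) = toWeight w x := by
    rw [← ENNReal.rpow_mul, mul_one_div_cancel hp0.ne', ENNReal.rpow_one]
  rw [← h]
  refine wienerNorm_le_of_lintegral_le hp0 ?_
  rw [← hm.inv x]
  refine (lintegral_mono fun y => ?_).trans
    (lintegral_mul_left_weight_le (hm.rpow hp0) (fun y => control μ Q F y ^ p) x⁻¹)
  gcongr
  exact control_leftTranslate _ _

/-- Right translations are bounded by the weight on an amalgam space over an IN group. -/
theorem exists_wienerOpNorm_rightTranslate_le (hV : IsInvariantNhd V) [μ.IsHaarMeasure]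
    [μ.IsMulRightInvariant] (hQ : IsWindow Q) (hm : IsSymmWeight (toWeight w)) (hp0 : 0 < p) :
    ∃ C : ℝ≥0∞, C ≠ ∞ ∧ ∀ x, wienerOpNorm μ Q p (toWeight w) (rightTranslate x) ≤
      C * toWeight w x := by
  obtain ⟨U, hU, hU1, hUQ⟩ : ∃ U : Set G, IsOpen U ∧ 1 ∈ U ∧ ∀ u ∈ U, ∀ v ∈ U, u * v ∈ Q := by
    have h : ∀ᶠ q : G × G in 𝓝 (1, 1), q.1 * q.2 ∈ Q :=
      ContinuousAt.eventually_mem (f := fun q : G × G => q.1 * q.2) (by fun_prop)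
        (by simpa using hQ.mem_nhds)
    obtain ⟨U, hU, h1, hUQ⟩ := exists_nhds_square (s := {q : G × G | q.1 * q.2 ∈ Q})
      (x := (1 : G)) h
    exact ⟨U, hU, h1, fun v hv w hw => hUQ (Set.mk_mem_prod hv hw)⟩
  obtain ⟨T, hT⟩ := exists_finset_cover hQ.isCompact_closure hV.isOpen hV.one_mem
  obtain ⟨S, hS⟩ := exists_finset_cover hV.isCompact_closure hU hU1
  set m := toWeight w
  have hmp := hm.rpow hp0
  -- Only `V` lets right translation pass through the window, so `Q` is covered by translates of `V`
  -- and `V` by translates of `U`. `D` collects the weights of the finitely many centres.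
  set D : ℝ≥0∞ := ∑ t ∈ T, ∑ s ∈ S, m t ^ p * m s ^ p
  have hD : D ≠ ∞ := (ENNReal.sum_lt_top.2 fun t _ => ENNReal.sum_lt_top.2 fun s _ =>
    ENNReal.mul_lt_top (hmp.ne_top t).lt_top (hmp.ne_top s).lt_top).ne
  refine ⟨D ^ (1 / p), ENNReal.rpow_ne_top_of_nonneg (by positivity) hD, fun x =>
    wienerOpNorm_le fun F _ => ?_⟩
  have h : D ^ (1 / p) * m x = (D * m x ^ p) ^ (1 / p) := by
    rw [ENNReal.mul_rpow_of_nonneg _ _ (by positivity), ← ENNReal.rpow_mul,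
      mul_one_div_cancel hp0.ne', ENNReal.rpow_one]
  rw [h]
  refine wienerNorm_le_of_lintegral_le hp0 ?_
  -- A measurable function between the control functions for `U` and `Q`: open local suprema are
  -- lower semicontinuous, and `UU ⊆ Q` gives the upper bound.
  set M : G → ℝ≥0∞ := localSup U (fun y => control μ U F y ^ p)
  have hM : LowerSemicontinuous M := lowerSemicontinuous_localSup_of_isOpen hU _
  have hMQ : ∀ y, M y ≤ control μ Q F y ^ p := fun y => localSup_le fun u hu => by
    gcongr
    refine control_mono ?_
    rintro _ ⟨v, hv, rfl⟩
    exact ⟨u * v, hUQ u hu v hv, by simp [mul_assoc]⟩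
  have hle : ∀ y, control μ Q (rightTranslate x F) y ^ p ≤
      ∑ t ∈ T, ∑ s ∈ S, M (y * (t * x * s)) := by
    intro y
    refine (control_rpow_le_sum hT hp0 y).trans (Finset.sum_le_sum fun t _ => ?_)
    calc control μ V (rightTranslate x F) (y * t) ^ p ≤ control μ V F (y * t * x) ^ p := by
          gcongr; exact hV.control_rightTranslate x (y * t)
      _ ≤ ∑ s ∈ S, control μ U F (y * t * x * s) ^ p := control_rpow_le_sum hS hp0 _
      _ ≤ _ := Finset.sum_le_sum fun s _ => by
          rw [show y * (t * x * s) = y * t * x * s by simp only [mul_assoc]]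
          exact self_le_localSup hU1 (fun y => control μ U F y ^ p) _
  have hmeas : ∀ t s, Measurable fun y => M (y * (t * x * s)) * m y ^ p := fun t s =>
    (hM.measurable.comp (measurable_mul_const _)).mul hmp.continuous.measurable
  calc ∫⁻ y, control μ Q (rightTranslate x F) y ^ p * m y ^ p ∂μ
      ≤ ∫⁻ y, ∑ t ∈ T, ∑ s ∈ S, M (y * (t * x * s)) * m y ^ p ∂μ := by
        refine lintegral_mono fun y => ?_
        simp only [← Finset.sum_mul]
        gcongr
        exact hle y
    _ = ∑ t ∈ T, ∑ s ∈ S, ∫⁻ y, M (y * (t * x * s)) * m y ^ p ∂μ := by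
        rw [lintegral_finsetSum _ fun t _ => Finset.measurable_fun_sum _ fun s _ => hmeas t s]
        simp only [lintegral_finsetSum _ fun s _ => hmeas _ s]
    _ ≤ ∑ t ∈ T, ∑ s ∈ S, (m t ^ p * m s ^ p) *
          (m x ^ p * ∫⁻ y, control μ Q F y ^ p * m y ^ p ∂μ) := by
        refine Finset.sum_le_sum fun t _ => Finset.sum_le_sum fun s _ => ?_
        refine (lintegral_mul_right_weight_le hmp M (t * x * s)).trans ?_
        rw [← mul_assoc]
        refine mul_le_mul' ?_ (lintegral_mono fun y => mul_le_mul' (hMQ y) le_rfl)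
        calc m (t * x * s) ^ p ≤ m (t * x) ^ p * m s ^ p := hmp.mul_le _ _
          _ ≤ (m t ^ p * m x ^ p) * m s ^ p := by gcongr; exact hmp.mul_le _ _
          _ = _ := by ring
    _ = _ := by simp only [← Finset.sum_mul]; rw [mul_assoc]

theorem exists_rightWeight_le (hV : IsInvariantNhd V) [μ.IsHaarMeasure]
    [μ.IsMulRightInvariant] (hQ : IsWindow Q) (hm : IsSymmWeight (toWeight w)) (hp0 : 0 < p) :
    ∃ C : ℝ≥0∞, C ≠ ∞ ∧ ∀ x, rightWeight μ Q p w x ≤ C * toWeight w x := by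
  obtain ⟨C, hC, h⟩ := exists_wienerOpNorm_rightTranslate_le (μ := μ) hV hQ hm hp0
  refine ⟨C, hC, fun x => max_le (h x) ?_⟩
  rw [haarModule_eq_one μ, ENNReal.coe_one, one_mul, ← hm.inv x]
  exact h x⁻¹

/-- An operator that moves the indicator of `V` to an open set where the weight is at least
comparable to `m x` has operator norm at least comparable to `m x`. -/
theorem exists_le_wienerOpNorm (hV : IsInvariantNhd V) [μ.IsHaarMeasure]
    [μ.IsMulRightInvariant] (hQ : IsWindow Q) (hm : IsSymmWeight (toWeight w)) (hp0 : 0 < p) :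
    ∃ C : ℝ≥0∞, C ≠ ∞ ∧ ∀ (T : (G → ℂ) → G → ℂ) (x : G) (A : Set G), IsOpen A →
      T (V.indicator 1) = A.indicator 1 → μ V ≤ μ A →
      (∀ y ∈ A, ∃ v ∈ V, toWeight w x ≤ toWeight w v * toWeight w y) →
      toWeight w x ≤ C * wienerOpNorm μ Q p (toWeight w) T := by
  set m := toWeight w
  have hmp := hm.rpow hp0
  obtain ⟨B, hB, hBm⟩ := hm.exists_bound hV.isCompact_closure
  have h0 : μ V ≠ 0 := (hV.isOpen.measure_pos μ ⟨1, hV.one_mem⟩).ne'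
  have ht : μ V ≠ ∞ := measure_ne_top_of_isCompact_closure hV.isCompact_closure
  have hind : ∀ (A : Set G) (x : G), ‖A.indicator (1 : G → ℂ) x‖ₑ =
      A.indicator (1 : G → ℝ≥0∞) x := fun A x => by
    by_cases hx : x ∈ A <;> simp [hx]
  have hlsc : ∀ A : Set G, IsOpen A →
      LowerSemicontinuous fun x => ‖A.indicator (1 : G → ℂ) x‖ₑ := fun A hA => by
    simp only [hind]
    exact hA.lowerSemicontinuous_indicator zero_le_one
  set F₀ : G → ℂ := V.indicator 1
  have hF₀ : MemWiener μ Q p m F₀ := by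
    refine ⟨(aestronglyMeasurable_one.indicator hV.isOpen.measurableSet), fun C hC => ?_, ?_⟩
    · rw [eLpNorm_exponent_top]
      refine (eLpNormEssSup_le_of_ae_bound (C := 1) (.of_forall fun x => ?_)).trans_lt
        ENNReal.ofReal_lt_top
      by_cases h1 : x ∈ C <;> by_cases h2 : x ∈ V <;> simp [F₀, h1, h2]
    · rw [wienerNorm_lt_top_iff_isAmalgam hQ hm hp0 (hlsc V hV.isOpen)]
      have hVV := isCompact_closure_mul hV.isCompact_closure hV.isCompact_closure
      obtain ⟨B', hB', hBm'⟩ := hmp.exists_bound hVV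
      refine isAmalgam_of_isOpen hmp (ENNReal.continuous_rpow_const.comp_lowerSemicontinuous
        (hlsc V hV.isOpen) (ENNReal.monotone_rpow_of_nonneg hp0.le)) hV.isOpen hV.one_mem ?_
      have hle : ∀ x, localSup V (fun y => ‖F₀ y‖ₑ ^ p) x * m x ^ p ≤
          (V * V).indicator (fun _ => B') x := by
        intro x
        by_cases hx : x ∈ V * V
        · rw [Set.indicator_of_mem hx, ← one_mul B']
          refine mul_le_mul' (localSup_le fun v _ => ?_) (hBm' x hx)
          refine ENNReal.rpow_le_one ?_ hp0.le
          rw [hind]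
          by_cases hv : x * v ∈ V <;> simp [hv]
        · rw [Set.indicator_of_notMem hx, nonpos_iff_eq_zero, mul_eq_zero]
          left
          refine le_antisymm (localSup_le fun v hv => ?_) zero_le
          have : x * v ∉ V := fun h => hx ⟨x * v, h, v⁻¹, hV.inv_mem v hv, by simp⟩
          rw [hind, Set.indicator_of_notMem this, ENNReal.zero_rpow_of_pos hp0]
      refine (lintegral_mono hle).trans_lt ?_
      rw [lintegral_indicator_const (hV.isOpen.mul_right).measurableSet]
      exact ENNReal.mul_lt_top hB'.lt_top (measure_ne_top_of_isCompact_closure hVV).lt_top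
  set N := wienerNorm μ Q p m F₀
  have hN : N ≠ ∞ := hF₀.norm_lt_top.ne
  set b : ℝ≥0∞ := μ V ^ (1 / p)
  have hb0 : b ≠ 0 := (ENNReal.rpow_pos (pos_iff_ne_zero.2 h0) ht).ne'
  have hbt : b ≠ ∞ := ENNReal.rpow_ne_top_of_nonneg (by positivity) ht
  -- The summand `1` keeps `C` nonzero, as division by `C` requires.
  set C := B * N / b + 1
  have hC : C ≠ ∞ := ENNReal.add_ne_top.2
    ⟨(ENNReal.div_lt_top (ENNReal.mul_ne_top hB hN) hb0).ne, by simp⟩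
  refine ⟨C, hC, fun T x A hA hTA hVA hx => ?_⟩
  have hC0 : C ≠ 0 := by simp [C]
  -- On `A` the control function of the image is at least `1` and the weight is at least `m x / B`,
  -- while `A` has measure at least `μ V`.
  have hkey : m x * b ≤ B * wienerNorm μ Q p m (T F₀) := by
    have h1 : m x ^ p * μ V ≤ B ^ p * ∫⁻ y, (control μ Q (T F₀) y * m y) ^ p ∂μ := by
      calc m x ^ p * μ V ≤ m x ^ p * μ A := by gcongr
        _ = ∫⁻ y in A, m x ^ p ∂μ := (setLIntegral_const _ _).symm
        _ ≤ ∫⁻ y in A, B ^ p * (control μ Q (T F₀) y * m y) ^ p ∂μ := by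
            refine setLIntegral_mono' hA.measurableSet fun y hy => ?_
            rw [← ENNReal.mul_rpow_of_nonneg _ _ hp0.le]
            refine ENNReal.rpow_le_rpow ?_ hp0.le
            obtain ⟨v, hv, hvy⟩ := hx y hy
            have hone : 1 ≤ control μ Q (T F₀) y := by
              rw [hTA]
              refine le_trans ?_ (localSup_le_control isOpen_interior interior_subset
                (hlsc A hA) y)
              refine le_trans ?_ (self_le_localSup
                (mem_interior_iff_mem_nhds.2 hQ.mem_nhds) _ y)
              simp [hy]
            calc m x ≤ m v * m y := hvy
              _ ≤ B * (1 * m y) := by rw [one_mul]; gcongr; exact hBm v hv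
              _ ≤ _ := by gcongr
        _ ≤ ∫⁻ y, B ^ p * (control μ Q (T F₀) y * m y) ^ p ∂μ := setLIntegral_le_lintegral _ _
        _ = _ := lintegral_const_mul' _ _ (ENNReal.rpow_ne_top_of_nonneg hp0.le hB)
    have h2 := ENNReal.rpow_le_rpow h1 (z := 1 / p) (by positivity)
    rw [ENNReal.mul_rpow_of_nonneg _ _ (by positivity),
      ENNReal.mul_rpow_of_nonneg _ _ (by positivity), ← ENNReal.rpow_mul, ← ENNReal.rpow_mul,
      mul_one_div_cancel hp0.ne', ENNReal.rpow_one, ENNReal.rpow_one] at h2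
    exact h2
  rw [mul_comm, ← ENNReal.div_le_iff hC0 hC]
  refine le_sInf fun c hc => ?_
  rw [ENNReal.div_le_iff hC0 hC]
  have h3 : m x * b ≤ B * (c * N) := hkey.trans (by gcongr; exact hc F₀ hF₀)
  calc m x ≤ B * (c * N) / b := (ENNReal.le_div_iff_mul_le (Or.inl hb0) (Or.inl hbt)).2 h3
    _ = c * (B * N / b) := by simp only [div_eq_mul_inv]; ring
    _ ≤ c * C := by gcongr; exact le_self_add

theorem exists_le_leftWeight (hV : IsInvariantNhd V) [μ.IsHaarMeasure]
    [μ.IsMulRightInvariant] (hQ : IsWindow Q) (hm : IsSymmWeight (toWeight w)) (hp0 : 0 < p) :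
    ∃ C : ℝ≥0∞, C ≠ ∞ ∧ ∀ x, toWeight w x ≤ C * leftWeight μ Q p w x := by
  obtain ⟨C, hC, h⟩ := exists_le_wienerOpNorm (μ := μ) hV hQ hm hp0
  refine ⟨C, hC, fun x => ?_⟩
  refine (h (leftTranslate x⁻¹) x ((x * ·) ⁻¹' V) (hV.isOpen.preimage (continuous_const_mul x))
    ?_ (measure_preimage_mul μ x V).ge fun y hy => ⟨x * y, hy, ?_⟩).trans ?_
  · ext y
    simp only [leftTranslate, inv_inv]
    rfl
  · calc toWeight w x ≤ toWeight w (x * y) * toWeight w y⁻¹ := by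
          simpa using hm.mul_le (x * y) y⁻¹
      _ = _ := by rw [hm.inv]
  · gcongr
    exact le_max_right _ _

theorem exists_le_rightWeight (hV : IsInvariantNhd V) [μ.IsHaarMeasure]
    [μ.IsMulRightInvariant] (hQ : IsWindow Q) (hm : IsSymmWeight (toWeight w)) (hp0 : 0 < p) :
    ∃ C : ℝ≥0∞, C ≠ ∞ ∧ ∀ x, toWeight w x ≤ C * rightWeight μ Q p w x := by
  obtain ⟨C, hC, h⟩ := exists_le_wienerOpNorm (μ := μ) hV hQ hm hp0
  refine ⟨C, hC, fun x => ?_⟩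
  refine (h (rightTranslate x) x ((· * x) ⁻¹' V) (hV.isOpen.preimage (continuous_mul_const x))
    ?_ (measure_preimage_mul_right μ x V).ge fun y hy => ⟨y * x, hy, ?_⟩).trans ?_
  · rfl
  · calc toWeight w x ≤ toWeight w y⁻¹ * toWeight w (y * x) := by
          simpa using hm.mul_le y⁻¹ (y * x)
      _ = _ := by rw [hm.inv, mul_comm]
  · gcongr
    exact le_max_left _ _

end OperatorNorms

/-! ### Error of Riemann sums. -/

section RiemannSums

variable {G : Type*} [Group G] [TopologicalSpace G] [IsTopologicalGroup G] [LocallyCompactSpace G]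
  [T2Space G] [MeasurableSpace G] [BorelSpace G] {μ : Measure G}

/-- On the first `N` cells the error is the variation of `θ` from its value at the centre; the rest
of the support of `a` lies in later cells. It serves both for a functional along an orbit and for
pointwise values of voice transforms. -/
theorem IsDiscretization.enorm_integral_sub_sum_le {U : Set G} {a θ : G → ℂ} {x : ℕ → G}
    {E : ℕ → Set G} (h : IsDiscretization U (fun y => ‖a y‖ₑ) x E) (ha : Integrable a μ)
    (haθ : Integrable (fun y => a y * θ y) μ) {δ β : ℕ → ℝ≥0∞}
    (hδt : ∀ n, δ n ≠ ∞) (hβt : ∀ n, β n ≠ ∞)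
    (hδ : ∀ n, ∀ y ∈ E n, ‖θ y - θ (x n)‖ₑ ≤ δ n) (hβ : ∀ n, ∀ y ∈ E n, ‖θ y‖ₑ ≤ β n) (N : ℕ) :
    ‖∫ y, a y * θ y ∂μ - ∑ n ∈ Finset.range N, (∫ y in E n, a y ∂μ) * θ (x n)‖ₑ ≤
      ∑ n ∈ Finset.range N, (∫⁻ y in E n, ‖a y‖ₑ ∂μ) * δ n +
        ∑' n, (∫⁻ y in E (n + N), ‖a y‖ₑ ∂μ) * β (n + N) := by
  set B : Set G := ⋃ n ∈ Finset.range N, E n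
  have hB : MeasurableSet B := Finset.measurableSet_biUnion _ fun n _ => h.measurableSet n
  have h1 : ∫ y in B, a y * θ y ∂μ = ∑ n ∈ Finset.range N, ∫ y in E n, a y * θ y ∂μ :=
    integral_biUnion_finset _ (fun n _ => h.measurableSet n)
      (fun i _ j _ hij => h.disjoint hij) fun n _ => haθ.integrableOn
  have hsplit : ∫ y, a y * θ y ∂μ - ∑ n ∈ Finset.range N, (∫ y in E n, a y ∂μ) * θ (x n) =
      ∑ n ∈ Finset.range N, ∫ y in E n, a y * (θ y - θ (x n)) ∂μ +
        ∫ y in Bᶜ, a y * θ y ∂μ := by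
    rw [← integral_add_compl hB haθ, h1, add_sub_right_comm, ← Finset.sum_sub_distrib]
    congr 1
    refine Finset.sum_congr rfl fun n _ => ?_
    rw [← integral_mul_const, ← integral_sub haθ.integrableOn (ha.mul_const _).integrableOn]
    simp only [mul_sub]
  rw [hsplit]
  refine (enorm_add_le _ _).trans (add_le_add ((enorm_sum_le _ _).trans
    (Finset.sum_le_sum fun n _ => ?_)) ?_)
  · refine (enorm_integral_le_lintegral_enorm _).trans ?_
    rw [← lintegral_mul_const' _ _ (hδt n)]
    refine setLIntegral_mono' (h.measurableSet n) fun y hy => ?_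
    rw [enorm_mul]
    gcongr
    exact hδ n y hy
  · refine (enorm_integral_le_lintegral_enorm _).trans ?_
    have h2 : ∫⁻ y in Bᶜ, ‖a y * θ y‖ₑ ∂μ ≤ ∫⁻ y in ⋃ n, E (n + N), ‖a y * θ y‖ₑ ∂μ := by
      rw [← lintegral_indicator hB.compl,
        ← lintegral_indicator (MeasurableSet.iUnion fun n => h.measurableSet _)]
      refine lintegral_mono fun y => ?_
      by_cases hyB : y ∈ Bᶜ
      · rw [Set.indicator_of_mem hyB]
        by_cases hya : ‖a y‖ₑ = 0
        · rw [enorm_mul, hya, zero_mul]; exact zero_le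
        · obtain ⟨n, hn⟩ := h.cover y hya
          have hnN : N ≤ n := by
            by_contra! hlt
            exact hyB (Set.mem_biUnion (Finset.mem_coe.2 (Finset.mem_range.2 hlt)) hn)
          have : y ∈ ⋃ n, E (n + N) := Set.mem_iUnion.2 ⟨n - N, by rwa [Nat.sub_add_cancel hnN]⟩
          rw [Set.indicator_of_mem this]
      · rw [Set.indicator_of_notMem hyB]; exact zero_le
    refine h2.trans ((lintegral_iUnion_le _ _).trans (ENNReal.tsum_le_tsum fun n => ?_))
    rw [← lintegral_mul_const' _ _ (hβt _)]
    refine setLIntegral_mono' (h.measurableSet _) fun y hy => ?_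
    rw [enorm_mul]
    gcongr
    exact hβ _ y hy

end RiemannSums

/-! ### Bounded functionals and the reproducing formula. -/

section Functionals

variable {G : Type*} [Group G] [TopologicalSpace G] [IsTopologicalGroup G] [LocallyCompactSpace G]
  [T2Space G] [MeasurableSpace G] [BorelSpace G] {μ : Measure G}
variable {H : Type*} [NormedAddCommGroup H] [InnerProductSpace ℂ H] [CompleteSpace H]
  {π : G →* unitary (H →L[ℂ] H)} {m : G → ℝ≥0∞} {V : Set G} {g₀ g₁ : H}

/-- The oscillation of the voice transform `V_{g₁} g₀` under left translations by elements
of `U`. -/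
noncomputable def oscillation (π : G →* unitary (H →L[ℂ] H)) (g₁ g₀ : H) (U : Set G)
    (z : G) : ℝ≥0∞ :=
  ⨆ u ∈ U, ‖voice π g₁ ((π u : H →L[ℂ] H) g₀ - g₀) z‖ₑ

theorem enorm_voice_le_oscillation {U : Set G} {u : G} (hu : u ∈ U) (z : G) :
    ‖voice π g₁ ((π u : H →L[ℂ] H) g₀ - g₀) z‖ₑ ≤ oscillation π g₁ g₀ U z :=
  le_iSup₂ (f := fun u (_ : u ∈ U) => ‖voice π g₁ ((π u : H →L[ℂ] H) g₀ - g₀) z‖ₑ) u hu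

theorem lowerSemicontinuous_oscillation (hπ : IsIrreducibleUnitaryRep π) (U : Set G) :
    LowerSemicontinuous (oscillation π g₁ g₀ U) :=
  lowerSemicontinuous_biSup fun _ _ =>
    (hπ.continuous_enorm_voice _ _).lowerSemicontinuous

theorem enorm_voice_rep_le_localSup (hV : IsInvariantNhd V) {u : G} (hu : u ∈ V) (g f : H) (z : G) :
    ‖voice π g ((π u : H →L[ℂ] H) f) z‖ₑ ≤ localSup V (fun x => ‖voice π g f x‖ₑ) z := by
  rw [voice_rep]
  have h1 := hV.conj_mem z⁻¹ _ (hV.inv_mem u hu)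
  simpa [mul_assoc] using le_localSup (fun x => ‖voice π g f x‖ₑ) z h1

theorem oscillation_le_localSup (hV : IsInvariantNhd V) {U : Set G} (hU : U ⊆ V) (z : G) :
    oscillation π g₁ g₀ U z ≤ 2 * localSup V (fun x => ‖voice π g₁ g₀ x‖ₑ) z := by
  refine iSup₂_le fun u hu => ?_
  rw [voice_sub, two_mul]
  refine enorm_sub_le.trans (add_le_add ?_ (self_le_localSup hV.one_mem _ z))
  exact enorm_voice_rep_le_localSup hV (hU hu) g₁ g₀ z

/-- Dominated convergence: strong continuity at the identity makes the oscillation tend to zero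
pointwise, and twice the local supremum over `V` dominates it. -/
theorem exists_lintegral_oscillation_le (hπ : IsIrreducibleUnitaryRep π) (hV : IsInvariantNhd V)
    (hm : IsSymmWeight m) (h : IsAmalgam μ m fun x => ‖voice π g₁ g₀ x‖ₑ) {ε : ℝ≥0∞}
    (hε : ε ≠ 0) : ∃ U ∈ 𝓝 (1 : G), U ⊆ V ∧ ∫⁻ z, oscillation π g₁ g₀ U z * m z ∂μ ≤ ε := by
  let U : ℕ → Set G := fun n => V ∩ {u | ‖(π u : H →L[ℂ] H) g₀ - g₀‖ < 1 / ((n : ℝ) + 1)}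
  have hU : ∀ n, U n ∈ 𝓝 (1 : G) := fun n => by
    refine Filter.inter_mem (hV.isOpen.mem_nhds hV.one_mem) ?_
    have hcont : Continuous fun u : G => ‖(π u : H →L[ℂ] H) g₀ - g₀‖ :=
      ((hπ.continuous g₀).sub continuous_const).norm
    refine (isOpen_lt hcont continuous_const).mem_nhds ?_
    simp only [Set.mem_ofPred_eq, rep_one, sub_self, norm_zero]
    positivity
  have hlim : Filter.Tendsto (fun n => ∫⁻ z, oscillation π g₁ g₀ (U n) z * m z ∂μ) Filter.atTop
      (𝓝 (∫⁻ _, 0 ∂μ)) := by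
    refine tendsto_lintegral_of_dominated_convergence
      (fun z => 2 * localSup V (fun x => ‖voice π g₁ g₀ x‖ₑ) z * m z)
      (fun n => (lowerSemicontinuous_oscillation hπ _).measurable.mul hm.continuous.measurable)
      (fun n => .of_forall fun z => ?_) ?_ (.of_forall fun z => ?_)
    · exact mul_le_mul' (oscillation_le_localSup hV Set.inter_subset_left z) le_rfl
    · simp only [mul_assoc]
      rw [lintegral_const_mul' _ _ (by simp)]
      exact (ENNReal.mul_lt_top (by simp) (h.lintegral_lt_top V hV.isCompact_closure)).ne
    · have h1 : Filter.Tendsto (fun n : ℕ => ENNReal.ofReal (‖g₁‖ * (1 / ((n : ℝ) + 1))) * m z)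
          Filter.atTop (𝓝 0) := by
        have h2 := (ENNReal.continuous_ofReal.tendsto _).comp
          ((tendsto_one_div_add_atTop_nhds_zero_nat (𝕜 := ℝ)).const_mul ‖g₁‖)
        have h3 := ENNReal.Tendsto.mul_const h2 (Or.inr (hm.ne_top z))
        simpa using h3
      refine tendsto_of_tendsto_of_tendsto_of_le_of_le tendsto_const_nhds h1
        (fun n => zero_le) fun n => ?_
      change oscillation π g₁ g₀ (U n) z * m z ≤ _
      gcongr
      refine iSup₂_le fun u hu => ?_
      rw [← ofReal_norm]
      refine ENNReal.ofReal_le_ofReal ((norm_voice_le _ _ _).trans ?_)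
      gcongr
      exact hu.2.le
  rw [lintegral_zero] at hlim
  obtain ⟨n, hn⟩ := (hlim.eventually_lt_const (pos_iff_ne_zero.2 hε)).exists
  exact ⟨U n, hU n, Set.inter_subset_left, hn.le⟩

theorem voiceL1Norm_rep_le [μ.IsMulLeftInvariant] (hm : IsSymmWeight m) (g f : H) (z : G) :
    voiceL1Norm μ π m g ((π z : H →L[ℂ] H) f) ≤ m z * voiceL1Norm μ π m g f := by
  simp only [voiceL1Norm, voice_rep]
  exact lintegral_mul_left_weight_le hm (fun x => ‖voice π g f x‖ₑ) z

/-- Factor out `π(x)`: the difference is `π(x)` applied to `π(x⁻¹y)g₀ - g₀`. This gives continuity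
of the orbit in the `H^1_m` norm. -/
theorem voiceL1Norm_rep_sub_le [μ.IsMulLeftInvariant] (hm : IsSymmWeight m) {U : Set G} {x y : G}
    (h : x⁻¹ * y ∈ U) :
    voiceL1Norm μ π m g₁ ((π y : H →L[ℂ] H) g₀ - (π x : H →L[ℂ] H) g₀) ≤
      m x * ∫⁻ z, oscillation π g₁ g₀ U z * m z ∂μ := by
  have h1 : (π y : H →L[ℂ] H) g₀ - (π x : H →L[ℂ] H) g₀ =
      (π x : H →L[ℂ] H) ((π (x⁻¹ * y) : H →L[ℂ] H) g₀ - g₀) := by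
    rw [map_sub, ← rep_mul, mul_inv_cancel_left]
  rw [h1]
  refine (voiceL1Norm_rep_le hm _ _ _).trans ?_
  gcongr
  refine lintegral_mono fun z => ?_
  gcongr
  exact enorm_voice_le_oscillation h z

variable {S : Submodule ℂ H} {χ : S →ₗ[ℂ] ℂ} {C : ℝ≥0∞}

theorem continuous_functional_rep [μ.IsMulLeftInvariant] (hπ : IsIrreducibleUnitaryRep π)
    (hV : IsInvariantNhd V)
    (hm : IsSymmWeight m) (hg : IsAmalgam μ m fun x => ‖voice π g₁ g₀ x‖ₑ) (hC : C ≠ ∞)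
    (hχ : ∀ h, ‖χ h‖ₑ ≤ C * voiceL1Norm μ π m g₁ h)
    (hS : ∀ x : G, (π x : H →L[ℂ] H) g₀ ∈ S) :
    Continuous fun x => χ ⟨(π x : H →L[ℂ] H) g₀, hS x⟩ := by
  rw [continuous_iff_continuousAt]
  intro x
  rw [ContinuousAt, EMetric.tendsto_nhds]
  intro ε hε
  obtain ⟨η, hη, hηε⟩ := ENNReal.exists_nnreal_pos_mul_lt
    (ENNReal.mul_ne_top hC (hm.ne_top x)) hε.ne'
  obtain ⟨U, hU, -, hUη⟩ := exists_lintegral_oscillation_le hπ hV hm hg (ε := η)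
    (by exact_mod_cast hη.ne')
  have h1 : ∀ᶠ y in 𝓝 x, x⁻¹ * y ∈ U :=
    ContinuousAt.eventually_mem (f := fun y : G => x⁻¹ * y) (by fun_prop) (by simpa using hU)
  filter_upwards [h1] with y hy
  rw [edist_eq_enorm_sub, ← map_sub]
  refine lt_of_le_of_lt ((hχ _).trans ?_) hηε
  calc C * voiceL1Norm μ π m g₁ ((π y : H →L[ℂ] H) g₀ - (π x : H →L[ℂ] H) g₀)
      ≤ C * (m x * η) := by
        gcongr
        exact (voiceL1Norm_rep_sub_le hm hy).trans (by gcongr)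
    _ = _ := by ring

/-- A linear functional that is bounded for the norm of `H^1_m` commutes with the reproducing
formula. -/
theorem IsOrthogonality.integral_voice_mul_functional {κ : ℝ} (hκ : IsOrthogonality π μ κ)
    [μ.IsHaarMeasure] (hπ : IsIrreducibleUnitaryRep π) (hV : IsInvariantNhd V)
    (hm : IsSymmWeight m) (hg : IsAmalgam μ m fun x => ‖voice π g₁ g₀ x‖ₑ) (hC : C ≠ ∞)
    (hχ : ∀ h, ‖χ h‖ₑ ≤ C * voiceL1Norm μ π m g₁ h)
    (hS : ∀ x : G, (π x : H →L[ℂ] H) g₀ ∈ S) (h : S)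
    (hh : ∫⁻ x, ‖voice π g₀ (h : H) x‖ₑ * m x ∂μ < ∞) :
    ∫ x, voice π g₀ (h : H) x * χ ⟨(π x : H →L[ℂ] H) g₀, hS x⟩ ∂μ =
      κ * inner ℂ g₀ g₀ * χ h := by
  set a : G → ℂ := voice π g₀ (h : H)
  set Θ : G → ℂ := fun x => χ ⟨(π x : H →L[ℂ] H) g₀, hS x⟩
  set d : ℂ := κ * inner ℂ g₀ g₀
  have hacont : Continuous a := hπ.continuous_voice _ _
  have hΘcont : Continuous Θ := continuous_functional_rep hπ hV hm hg hC hχ hS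
  obtain ⟨B, hB, hBm⟩ := hm.exists_bound hV.isCompact_closure
  set n₀ := voiceL1Norm μ π m g₁ g₀
  have hn₀ : n₀ ≠ ∞ := hg.lintegral_mul_lt_top.ne
  set n₁ := ∫⁻ z, localSup V (fun x => ‖voice π g₁ g₀ x‖ₑ) z * m z ∂μ
  have hn₁ : n₁ ≠ ∞ := (hg.lintegral_lt_top V hV.isCompact_closure).ne
  have hΘ : ∀ x, ‖Θ x‖ₑ ≤ C * n₀ * m x := fun x => by
    refine (hχ _).trans ?_
    rw [mul_assoc]
    gcongr
    rw [mul_comm]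
    exact voiceL1Norm_rep_le hm g₁ g₀ x
  have hafin : ∫⁻ y, ‖a y‖ₑ ∂μ ≠ ∞ := by
    refine (lt_of_le_of_lt (lintegral_mono fun y => ?_) hh).ne
    simpa using mul_le_mul_right (hm.one_le y) ‖a y‖ₑ
  have ha : Integrable a μ := ⟨hacont.aestronglyMeasurable, hafin.lt_top⟩
  have haΘ : Integrable (fun y => a y * Θ y) μ := by
    refine ⟨(hacont.mul hΘcont).aestronglyMeasurable, ?_⟩
    calc ∫⁻ y, ‖a y * Θ y‖ₑ ∂μ ≤ ∫⁻ y, C * n₀ * (‖a y‖ₑ * m y) ∂μ := by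
          refine lintegral_mono fun y => ?_
          rw [enorm_mul]
          calc ‖a y‖ₑ * ‖Θ y‖ₑ ≤ ‖a y‖ₑ * (C * n₀ * m y) := by gcongr; exact hΘ y
            _ = _ := by ring
      _ = C * n₀ * ∫⁻ y, ‖a y‖ₑ * m y ∂μ :=
          lintegral_const_mul' _ _ (ENNReal.mul_ne_top hC hn₀)
      _ < ∞ := ENNReal.mul_lt_top (ENNReal.mul_ne_top hC hn₀).lt_top hh
  set s := B * ∫⁻ y, ‖a y‖ₑ * m y ∂μ
  have hs : s ≠ ∞ := ENNReal.mul_ne_top hB hh.ne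
  -- The first bracket comes from the scalar Riemann sum, the last term from the `H^1_m` error of
  -- the vector sum; neither depends on `ε`.
  set K : ℝ≥0∞ := (s * C + C * n₀ * B) + C * (s + n₁)
  have hK : K ≠ ∞ := by
    refine ENNReal.add_ne_top.2 ⟨ENNReal.add_ne_top.2 ⟨ENNReal.mul_ne_top hs hC,
      ENNReal.mul_ne_top (ENNReal.mul_ne_top hC hn₀) hB⟩, ENNReal.mul_ne_top hC
      (ENNReal.add_ne_top.2 ⟨hs, hn₁⟩)⟩
  suffices hsuff : ∀ ε : ℝ≥0, 0 < ε → ‖∫ y, a y * Θ y ∂μ - d * χ h‖ₑ ≤ ε * K by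
    by_contra hne
    have hne' : ‖∫ y, a y * Θ y ∂μ - d * χ h‖ₑ ≠ 0 := enorm_ne_zero.2 (sub_ne_zero.2 hne)
    obtain ⟨ε, hε, hlt⟩ := ENNReal.exists_nnreal_pos_mul_lt hK hne'
    exact (hsuff ε hε).not_gt hlt
  intro ε hε
  obtain ⟨U, hU, hUV, hUε⟩ := exists_lintegral_oscillation_le hπ hV hm hg (ε := ε)
    (by exact_mod_cast hε.ne')
  obtain ⟨x, E, hE⟩ := exists_isDiscretization μ hacont.enorm.lowerSemicontinuous hafin hU
  set α : ℕ → ℝ≥0∞ := fun n => ∫⁻ y in E n, ‖a y‖ₑ ∂μ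
  have hαt : ∀ n, α n ≠ ∞ := fun n =>
    ((setLIntegral_le_lintegral _ _).trans_lt hafin.lt_top).ne
  have hαs : ∑' n, α n * m (x n) ≤ s := hE.tsum_mul_le hm hB fun u hu => hBm u (hUV hu)
  obtain ⟨N, hN⟩ := ((ENNReal.tendsto_sum_nat_add (fun n => α n * m (x n))
    (ne_top_of_le_ne_top hs hαs)).eventually_lt_const
      (show (0 : ℝ≥0∞) < ε by exact_mod_cast hε)).exists
  have hαN : ∑ n ∈ Finset.range N, α n * m (x n) ≤ s := (ENNReal.sum_le_tsum _).trans hαs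
  set c : ℕ → ℂ := fun n => ∫ y in E n, a y ∂μ
  -- A finite Riemann sum for `d • h = ∫ V_{g₀}h(y) π(y)g₀ dy`. Linearity of `χ` is used only on
  -- this sum; it remains to show that `χ hN'` is close to the scalar integral and `hN'` to `d • h`
  -- in the `H^1_m` norm.
  set hN' : S := ∑ n ∈ Finset.range N, c n • ⟨(π (x n) : H →L[ℂ] H) g₀, hS (x n)⟩
  have hχN : χ hN' = ∑ n ∈ Finset.range N, c n * Θ (x n) := by
    simp only [hN', map_sum, map_smul, smul_eq_mul]; rfl
  have hcoeN : (hN' : H) = ∑ n ∈ Finset.range N, c n • (π (x n) : H →L[ℂ] H) g₀ := by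
    simp [hN']
  have hscalar : ‖∫ y, a y * Θ y ∂μ - χ hN'‖ₑ ≤ ε * (s * C + C * n₀ * B) := by
    rw [hχN]
    refine (hE.enorm_integral_sub_sum_le ha haΘ (δ := fun n => C * ε * m (x n))
      (β := fun n => C * n₀ * B * m (x n))
      (fun n => ENNReal.mul_ne_top (ENNReal.mul_ne_top hC (by simp)) (hm.ne_top _))
      (fun n => ENNReal.mul_ne_top (ENNReal.mul_ne_top (ENNReal.mul_ne_top hC hn₀) hB)
        (hm.ne_top _)) (fun n y hy => ?_) (fun n y hy => ?_) N).trans ?_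
    · rw [← map_sub]
      refine (hχ _).trans ?_
      rw [mul_assoc]
      gcongr
      rw [mul_comm]
      exact (voiceL1Norm_rep_sub_le hm (hE.mem n y hy)).trans (by gcongr)
    · refine (hΘ y).trans ?_
      rw [mul_assoc (C * n₀)]
      gcongr
      calc m y ≤ m (x n) * m ((x n)⁻¹ * y) := by simpa using hm.mul_le (x n) ((x n)⁻¹ * y)
        _ ≤ m (x n) * B := by gcongr; exact hBm _ (hUV (hE.mem n y hy))
        _ = _ := mul_comm _ _
    · rw [mul_add]
      refine add_le_add ?_ ?_
      · calc ∑ n ∈ Finset.range N, α n * (C * ε * m (x n))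
            = C * ε * ∑ n ∈ Finset.range N, α n * m (x n) := by
              rw [Finset.mul_sum]
              exact Finset.sum_congr rfl fun n _ => by ring
          _ ≤ C * ε * s := by gcongr
          _ = _ := by ring
      · calc ∑' n, α (n + N) * (C * n₀ * B * m (x (n + N)))
            = C * n₀ * B * ∑' n, α (n + N) * m (x (n + N)) := by
              rw [← ENNReal.tsum_mul_left]
              exact tsum_congr fun n => by ring
          _ ≤ C * n₀ * B * ε := by gcongr
          _ = _ := by ring
  -- By the reproducing formula `V_{g₁}(d • h)(z)` is itself an integral of `a` against
  -- `V_{g₁}g₀(y⁻¹z)`, so the Riemann sum estimate applies for each `z`.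
  have hpt : ∀ z, ‖voice π g₁ (d • (h : H) - hN') z‖ₑ ≤
      ∑ n ∈ Finset.range N, α n * oscillation π g₁ g₀ U ((x n)⁻¹ * z) +
        ∑' n, α (n + N) * localSup V (fun x => ‖voice π g₁ g₀ x‖ₑ) ((x (n + N))⁻¹ * z) := by
    intro z
    have hosct : ∀ y, localSup V (fun x => ‖voice π g₁ g₀ x‖ₑ) y ≠ ∞ := fun y =>
      ((localSup_le fun v _ => by
        rw [← ofReal_norm]
        exact ENNReal.ofReal_le_ofReal (norm_voice_le g₁ g₀ _)).trans_lt ENNReal.ofReal_lt_top).ne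
    have hint : Integrable (fun y => a y * voice π g₁ g₀ (y⁻¹ * z)) μ := by
      refine ha.mul_bdd (c := ‖g₁‖ * ‖g₀‖) ?_ (.of_forall fun y => norm_voice_le _ _ _)
      exact ((hπ.continuous_voice g₁ g₀).comp (by fun_prop)).aestronglyMeasurable
    have hvoice : voice π g₁ (d • (h : H) - hN') z =
        ∫ y, a y * voice π g₁ g₀ (y⁻¹ * z) ∂μ -
          ∑ n ∈ Finset.range N, c n * voice π g₁ g₀ ((x n)⁻¹ * z) := by
      rw [voice_sub, voice_smul, hκ.integral_voice_mul_voice, hcoeN]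
      congr 1
      simp only [voice, inner_sum, inner_smul_right]
      refine Finset.sum_congr rfl fun n _ => ?_
      have := voice_rep (π := π) g₁ g₀ (x n) z
      simp only [voice] at this
      rw [this]
    rw [hvoice]
    refine hE.enorm_integral_sub_sum_le (θ := fun y => voice π g₁ g₀ (y⁻¹ * z)) ha hint
      (δ := fun n => oscillation π g₁ g₀ U ((x n)⁻¹ * z))
      (β := fun n => localSup V (fun x => ‖voice π g₁ g₀ x‖ₑ) ((x n)⁻¹ * z))
      (fun n => ne_top_of_le_ne_top (ENNReal.mul_ne_top (by simp) (hosct _))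
        (oscillation_le_localSup hV hUV _)) (fun n => hosct _)
      (fun n y hy => ?_) (fun n y hy => ?_) N
    · have h1 := enorm_voice_le_oscillation (π := π) (g₁ := g₁) (g₀ := g₀) (hE.mem n y hy)
        ((x n)⁻¹ * z)
      rw [voice_sub, voice_rep] at h1
      simpa [mul_assoc] using h1
    · have h1 := enorm_voice_rep_le_localSup (π := π) hV (hUV (hE.mem n y hy)) g₁ g₀
        ((x n)⁻¹ * z)
      rw [voice_rep] at h1
      simpa [mul_assoc] using h1
  have hosc_meas := (lowerSemicontinuous_oscillation (g₁ := g₁) (g₀ := g₀) hπ U).measurable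
  have hsup_meas := (isAmalgam_localSup hg hV.isCompact_closure).lsc.measurable
  have hnorm : voiceL1Norm μ π m g₁ (d • (h : H) - hN') ≤ ε * (s + n₁) := by
    calc voiceL1Norm μ π m g₁ (d • (h : H) - hN')
        ≤ ∫⁻ z, (∑ n ∈ Finset.range N, α n * (oscillation π g₁ g₀ U ((x n)⁻¹ * z) * m z) +
          ∑' n, α (n + N) * (localSup V (fun x => ‖voice π g₁ g₀ x‖ₑ) ((x (n + N))⁻¹ * z) *
            m z)) ∂μ := by
          refine lintegral_mono fun z => ?_
          simp only [← mul_assoc, ENNReal.tsum_mul_right, ← Finset.sum_mul, ← add_mul]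
          gcongr
          exact hpt z
      _ = ∑ n ∈ Finset.range N, α n * ∫⁻ z, oscillation π g₁ g₀ U ((x n)⁻¹ * z) * m z ∂μ +
          ∑' n, α (n + N) * ∫⁻ z, localSup V (fun x => ‖voice π g₁ g₀ x‖ₑ)
            ((x (n + N))⁻¹ * z) * m z ∂μ := by
          have hm1 : ∀ n, Measurable fun z =>
              α n * (oscillation π g₁ g₀ U ((x n)⁻¹ * z) * m z) := fun n =>
            ((hosc_meas.comp (measurable_const_mul _)).mul hm.continuous.measurable).const_mul _
          have hm2 : ∀ n, Measurable fun z => α (n + N) *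
              (localSup V (fun x => ‖voice π g₁ g₀ x‖ₑ) ((x (n + N))⁻¹ * z) * m z) := fun n =>
            ((hsup_meas.comp (measurable_const_mul _)).mul hm.continuous.measurable).const_mul _
          rw [lintegral_add_left (Finset.measurable_fun_sum _ fun n _ => hm1 n),
            lintegral_finsetSum _ fun n _ => hm1 n, lintegral_tsum fun n => (hm2 n).aemeasurable]
          simp only [lintegral_const_mul' _ _ (hαt _)]
      _ ≤ ∑ n ∈ Finset.range N, α n * (m (x n) * ε) +
          ∑' n, α (n + N) * (m (x (n + N)) * n₁) := by
          gcongr with n _ n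
          · exact (lintegral_mul_left_weight_le hm _ _).trans (by gcongr)
          · exact lintegral_mul_left_weight_le hm _ _
      _ = (∑ n ∈ Finset.range N, α n * m (x n)) * ε +
          (∑' n, α (n + N) * m (x (n + N))) * n₁ := by
          simp only [← mul_assoc, ENNReal.tsum_mul_right, Finset.sum_mul]
      _ ≤ s * ε + ε * n₁ := by gcongr
      _ = _ := by ring
  have hfinal : ∫ y, a y * Θ y ∂μ - d * χ h =
      (∫ y, a y * Θ y ∂μ - χ hN') - χ (d • h - hN') := by
    rw [map_sub, map_smul, smul_eq_mul]; ring
  rw [hfinal]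
  refine enorm_sub_le.trans ?_
  rw [mul_add]
  refine add_le_add hscalar ((hχ _).trans ?_)
  calc C * voiceL1Norm μ π m g₁ ((d • h - hN' : S) : H) ≤ C * (ε * (s + n₁)) := by
        gcongr
        exact hnorm
    _ = _ := by ring

end Functionals

/-! ### Comparison of `𝔹^p_w` with the coorbit space. -/

section Coorbits

variable {G : Type*} [Group G] [TopologicalSpace G] [IsTopologicalGroup G] [LocallyCompactSpace G]
  [T2Space G] [MeasurableSpace G] [BorelSpace G] {μ : Measure G}
variable {H : Type*} [NormedAddCommGroup H] [InnerProductSpace ℂ H] [CompleteSpace H]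
  {π : G →* unitary (H →L[ℂ] H)} {Q V : Set G} {p κ : ℝ} {w : G → ℝ} {m : G → ℝ≥0∞}
  {g₀ g₁ : H}

theorem MemWiener.of_weight_le {m' : G → ℝ≥0∞} {F : G → ℂ} (hp0 : 0 < p)
    (h : MemWiener μ Q p m F) {C : ℝ≥0∞} (hC : C ≠ ∞) (hm : ∀ x, m' x ≤ C * m x) :
    MemWiener μ Q p m' F := by
  refine ⟨h.aestronglyMeasurable, h.locallyBounded, ?_⟩
  have h1 := (wienerNorm_lt_top_iff hp0).1 h.norm_lt_top
  rw [wienerNorm_lt_top_iff hp0]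
  have hCp : C ^ p ≠ ∞ := ENNReal.rpow_ne_top_of_nonneg hp0.le hC
  calc ∫⁻ x, control μ Q F x ^ p * m' x ^ p ∂μ
      ≤ ∫⁻ x, C ^ p * (control μ Q F x ^ p * m x ^ p) ∂μ := by
        refine lintegral_mono fun x => ?_
        calc control μ Q F x ^ p * m' x ^ p ≤ control μ Q F x ^ p * (C * m x) ^ p := by
              gcongr
              exact hm x
          _ = _ := by rw [ENNReal.mul_rpow_of_nonneg _ _ hp0.le]; ring
    _ = C ^ p * ∫⁻ x, control μ Q F x ^ p * m x ^ p ∂μ := lintegral_const_mul' _ _ hCp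
    _ < ∞ := ENNReal.mul_lt_top hCp.lt_top h1

theorem voiceL1Norm_lt_top_of_weight_le {m' : G → ℝ≥0∞} {g f : H}
    (h : voiceL1Norm μ π m g f < ∞) {C : ℝ≥0∞} (hC : C ≠ ∞) (hm : ∀ x, m' x ≤ C * m x) :
    voiceL1Norm μ π m' g f < ∞ := by
  calc voiceL1Norm μ π m' g f ≤ ∫⁻ x, C * (‖voice π g f x‖ₑ * m x) ∂μ := by
        refine lintegral_mono fun x => ?_
        calc ‖voice π g f x‖ₑ * m' x ≤ ‖voice π g f x‖ₑ * (C * m x) := by gcongr; exact hm x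
          _ = _ := by ring
    _ = C * voiceL1Norm μ π m g f := lintegral_const_mul' _ _ hC
    _ < ∞ := ENNReal.mul_lt_top hC.lt_top h

theorem IsSymmWeight.lintegral_lt_top (hm : IsSymmWeight m) {k : G → ℝ≥0∞}
    (h : ∫⁻ x, k x * m x ∂μ < ∞) : ∫⁻ x, k x ∂μ < ∞ :=
  lt_of_le_of_lt (lintegral_mono fun x => by
    simpa using mul_le_mul_right (hm.one_le x) (k x)) h

theorem IsIrreducibleUnitaryRep.memLp_two_voice (hπ : IsIrreducibleUnitaryRep π) {g f : H}
    (h : ∫⁻ x, ‖voice π g f x‖ₑ ∂μ < ∞) : MemLp (voice π g f) 2 μ := by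
  have hc := hπ.continuous_voice g f
  rw [memLp_two_iff_integrable_sq_norm hc.aestronglyMeasurable]
  have h1 : Integrable (voice π g f) μ := ⟨hc.aestronglyMeasurable, h⟩
  simp only [sq]
  exact h1.norm.mul_bdd (c := ‖g‖ * ‖f‖) hc.norm.aestronglyMeasurable
    (.of_forall fun x => by rw [norm_norm]; exact norm_voice_le g f x)

theorem IsOrthogonality.mem_BSpace_iff (hκ : IsOrthogonality π μ κ)
    (hπ : IsIrreducibleUnitaryRep π) [μ.IsHaarMeasure] [μ.IsMulRightInvariant] (hQ : IsWindow Q)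
    (hm : IsSymmWeight (toWeight w)) (hp0 : 0 < p) (g : H) :
    g ∈ BSpace μ π Q p w ↔
      IsAmalgam μ (fun x => toWeight w x ^ p) fun x => ‖voice π g g x‖ₑ ^ p := by
  rw [← memWiener_iff_isAmalgam hQ hm hp0 (hπ.continuous_voice g g)]
  exact ⟨fun h => h.2, fun h => ⟨hκ.memLp g g, h⟩⟩

theorem isAmalgam_voice_zero_right (hp0 : 0 < p) (g : H) :
    IsAmalgam μ m fun x => ‖voice π g 0 x‖ₑ ^ p := by
  simp only [voice_zero_right, Pi.zero_apply, enorm_zero, ENNReal.zero_rpow_of_pos hp0]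
  exact ⟨lowerSemicontinuous_const, fun A _ => by simp [localSup]⟩

theorem IsAmalgam.voice_of_rpow (hπ : IsIrreducibleUnitaryRep π) (hV : IsInvariantNhd V)
    [μ.IsHaarMeasure] [μ.IsMulRightInvariant] (hm : IsSymmWeight m) (hp0 : 0 < p) (hp1 : p ≤ 1)
    {g f : H} (h : IsAmalgam μ (fun x => m x ^ p) fun x => ‖voice π g f x‖ₑ ^ p) :
    IsAmalgam μ m fun x => ‖voice π g f x‖ₑ :=
  h.of_rpow hV hm hp0 hp1 (hπ.continuous_enorm_voice g f).lowerSemicontinuous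

theorem exists_isOrthogonality_of_isAmalgam (hπ : IsIrreducibleUnitaryRep π)
    (hV : IsInvariantNhd V) [μ.IsHaarMeasure] [μ.IsMulRightInvariant] [μ.IsInvInvariant]
    (hm : IsSymmWeight m) (hp0 : 0 < p) (hp1 : p ≤ 1) {f g : H} (hf : f ≠ 0) (hg : g ≠ 0)
    (h : IsAmalgam μ (fun x => m x ^ p) fun x => ‖voice π g f x‖ₑ ^ p) :
    ∃ κ, IsOrthogonality π μ κ :=
  hπ.exists_isOrthogonality hg hf (hπ.memLp_two_voice (hm.lintegral_lt_top
    (h.voice_of_rpow hπ hV hm hp0 hp1).lintegral_mul_lt_top))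

/-- If `V_g f` is in the amalgam space, then so are `V_f f` and `V_g g`. -/
theorem IsOrthogonality.mem_BSpace_of_isAmalgam (hκ : IsOrthogonality π μ κ)
    (hπ : IsIrreducibleUnitaryRep π) (hV : IsInvariantNhd V) [μ.IsHaarMeasure]
    [μ.IsMulRightInvariant] [μ.IsInvInvariant] (hQ : IsWindow Q)
    (hm : IsSymmWeight (toWeight w)) (hp0 : 0 < p) (hp1 : p ≤ 1) {f g : H} (hf : f ≠ 0)
    (hg : g ≠ 0)
    (h : IsAmalgam μ (fun x => toWeight w x ^ p) fun x => ‖voice π g f x‖ₑ ^ p) :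
    f ∈ BSpace μ π Q p w ∧ g ∈ BSpace μ π Q p w := by
  have hmp := hm.rpow hp0
  have h' := isAmalgam_voice_swap hV hmp h
  rw [hκ.mem_BSpace_iff hπ hQ hm hp0, hκ.mem_BSpace_iff hπ hQ hm hp0]
  exact ⟨hκ.isAmalgam_voice hπ hV hmp hp0 hp1 hg hg h h',
    hκ.isAmalgam_voice hπ hV hmp hp0 hp1 hf hf h' h⟩

theorem IsOrthogonality.BSpace_subset_BY (hκ : IsOrthogonality π μ κ)
    (hπ : IsIrreducibleUnitaryRep π) (hV : IsInvariantNhd V) [μ.IsHaarMeasure]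
    [μ.IsMulRightInvariant] (hQ : IsWindow Q) (hm : IsSymmWeight (toWeight w)) (hp0 : 0 < p)
    (hp1 : p ≤ 1) : BSpace μ π Q p w ⊆ BY μ π Q p w := by
  intro g hg
  obtain ⟨C, hC, hCle⟩ := exists_rightWeight_le (μ := μ) hV hQ hm hp0
  refine ⟨⟨hg.1, hg.2.of_weight_le hp0 hC hCle⟩, ?_⟩
  have h1 := ((hκ.mem_BSpace_iff hπ hQ hm hp0 g).1 hg).voice_of_rpow hπ hV hm hp0 hp1
  exact voiceL1Norm_lt_top_of_weight_le (m := toWeight w) h1.lintegral_mul_lt_top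
    ENNReal.one_ne_top fun x => by rw [one_mul]; exact leftWeight_le hm hp0 x

theorem BY_subset_BSpace (hV : IsInvariantNhd V) [μ.IsHaarMeasure]
    [μ.IsMulRightInvariant] (hQ : IsWindow Q) (hm : IsSymmWeight (toWeight w)) (hp0 : 0 < p) :
    BY μ π Q p w ⊆ BSpace μ π Q p w := by
  intro g hg
  obtain ⟨C, hC, hCle⟩ := exists_le_rightWeight (μ := μ) hV hQ hm hp0
  exact ⟨hg.1.1, hg.1.2.of_weight_le hp0 hC hCle⟩

/-- Orthogonality writes a nonzero multiple of `⟨f, h⟩` as the `L²` pairing of `V_g f` with `V_g h`,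
where `V_g f` is bounded and `v ≥ 1`. -/
theorem IsOrthogonality.isBoundedAntifunctional (hκ : IsOrthogonality π μ κ)
    (hπ : IsIrreducibleUnitaryRep π) {v : G → ℝ≥0∞} (hv : ∀ x, 1 ≤ v x) {g : H} (hg : g ≠ 0)
    (f : H) : IsBoundedAntifunctional μ hπ v g (toAntifunctional μ hπ v g f) := by
  set d : ℂ := κ * inner ℂ g g
  have hd : d ≠ 0 := mul_ne_zero (by exact_mod_cast hκ.ne_zero) (inner_self_ne_zero.2 hg)
  refine ⟨‖d⁻¹‖₊ * ‖‖g‖ * ‖f‖‖₊, fun h => ?_⟩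
  change ‖inner ℂ (h : H) f‖ₑ ≤ _
  have h1 : inner ℂ (h : H) f =
      d⁻¹ * ∫ x, inner ℂ (voice π g h x) (voice π g f x) ∂μ := by
    rw [hκ.integral_inner, eq_inv_mul_iff_mul_eq₀ hd]
    ring
  rw [h1, enorm_mul, ENNReal.coe_mul, mul_assoc]
  change ‖d⁻¹‖ₑ * _ ≤ ‖d⁻¹‖ₑ * (‖‖g‖ * ‖f‖‖ₑ * _)
  gcongr
  refine (enorm_integral_le_lintegral_enorm _).trans ?_
  rw [voiceL1Norm, ← lintegral_const_mul' _ _ enorm_ne_top]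
  refine lintegral_mono fun x => ?_
  have h2 : ‖voice π g f x‖ₑ ≤ ‖‖g‖ * ‖f‖‖ₑ := by
    rw [enorm_le_iff_norm_le, Real.norm_of_nonneg (by positivity)]
    exact norm_voice_le g f x
  calc ‖inner ℂ (voice π g h x) (voice π g f x)‖ₑ = ‖voice π g h x‖ₑ * ‖voice π g f x‖ₑ := by
        rw [show inner ℂ (voice π g h x) (voice π g f x) =
          voice π g f x * starRingEnd ℂ (voice π g h x) from rfl, enorm_mul, mul_comm]
        congr 1
        rw [← ofReal_norm, RCLike.norm_conj, ofReal_norm]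
    _ ≤ ‖voice π g h x‖ₑ * v x * ‖‖g‖ * ‖f‖‖ₑ := by
        gcongr
        simpa using mul_le_mul_right (hv x) ‖voice π g h x‖ₑ
    _ = _ := mul_comm _ _

theorem one_le_leftWeight (x : G) : 1 ≤ leftWeight μ Q p w x := le_max_left _ _

theorem IsOrthogonality.mapsTo_toAntifunctional (hκ : IsOrthogonality π μ κ)
    (hπ : IsIrreducibleUnitaryRep π) (hV : IsInvariantNhd V) [μ.IsHaarMeasure]
    [μ.IsMulRightInvariant] (hQ : IsWindow Q) (hm : IsSymmWeight (toWeight w)) (hp0 : 0 < p)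
    (hp1 : p ≤ 1) (hg₁ : g₁ ≠ 0) (hg₀ : g₀ ≠ 0) (hg₀B : g₀ ∈ BSpace μ π Q p w)
    (hS : ∀ x : G, (π x : H →L[ℂ] H) g₀ ∈ HOne μ hπ (leftWeight μ Q p w) g₁) :
    Set.MapsTo (toAntifunctional μ hπ (leftWeight μ Q p w) g₁) (BSpace μ π Q p w)
      (CoorbitSpace μ hπ Q p w g₁ g₀ hS) := by
  intro f hf
  refine ⟨hκ.isBoundedAntifunctional hπ one_le_leftWeight hg₁ f, ?_⟩
  change MemWiener μ Q p (toWeight w) (voice π g₀ f)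
  rw [memWiener_iff_isAmalgam hQ hm hp0 (hπ.continuous_voice g₀ f)]
  rcases eq_or_ne f 0 with rfl | hf0
  · exact isAmalgam_voice_zero_right hp0 g₀
  · rw [hκ.mem_BSpace_iff hπ hQ hm hp0] at hf hg₀B
    exact hκ.isAmalgam_voice hπ hV (hm.rpow hp0) hp0 hp1 hf0 hg₀ hf hg₀B

theorem injective_toAntifunctional (hπ : IsIrreducibleUnitaryRep π) {v : G → ℝ≥0∞}
    (hg₀ : g₀ ≠ 0) (hS : ∀ x : G, (π x : H →L[ℂ] H) g₀ ∈ HOne μ hπ v g₁) :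
    Function.Injective (toAntifunctional μ hπ v g₁) := by
  intro f f' h
  by_contra hne
  obtain ⟨z, hz⟩ := hπ.exists_inner_ne_zero hg₀ (sub_ne_zero.2 hne)
  refine hz ?_
  have h1 := LinearMap.congr_fun h ⟨_, hS z⟩
  change inner ℂ ((π z : H →L[ℂ] H) g₀) f = inner ℂ ((π z : H →L[ℂ] H) g₀) f' at h1
  rw [inner_sub_right, h1, sub_self]

/-- Integrability of `Φ` lets the reproducing formula define an extension of the conjugate of `φ` to
all of `H`. Riesz represents it by a vector `f` with `V_{g₀} f = Φ`, and amalgam membership of `Φ`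
puts `f` in `𝔹^p_w`. -/
theorem IsOrthogonality.surjOn_toAntifunctional (hκ : IsOrthogonality π μ κ)
    (hπ : IsIrreducibleUnitaryRep π) (hV : IsInvariantNhd V) [μ.IsHaarMeasure]
    [μ.IsMulRightInvariant] [μ.IsInvInvariant] (hQ : IsWindow Q)
    (hm : IsSymmWeight (toWeight w)) (hp0 : 0 < p) (hp1 : p ≤ 1) (hg₁ : g₁ ≠ 0) (hg₀ : g₀ ≠ 0)
    (hg₁₀ : IsAmalgam μ (toWeight w) fun x => ‖voice π g₁ g₀ x‖ₑ)
    (hg₀₁ : IsAmalgam μ (toWeight w) fun x => ‖voice π g₀ g₁ x‖ₑ)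
    (hS : ∀ x : G, (π x : H →L[ℂ] H) g₀ ∈ HOne μ hπ (leftWeight μ Q p w) g₁) :
    Set.SurjOn (toAntifunctional μ hπ (leftWeight μ Q p w) g₁) (BSpace μ π Q p w)
      (CoorbitSpace μ hπ Q p w g₁ g₀ hS) := by
  rintro φ ⟨⟨C, hC⟩, hφ⟩
  set m := toWeight w
  let χ : HOne μ hπ (leftWeight μ Q p w) g₁ →ₗ[ℂ] ℂ :=
    { toFun := fun h => starRingEnd ℂ (φ h)
      map_add' := fun a b => by rw [map_add, map_add]
      map_smul' := fun c a => by
        rw [LinearMap.map_smulₛₗ, smul_eq_mul, map_mul, RCLike.conj_conj]; rfl }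
  have hnorm : ∀ h, ‖χ h‖ₑ = ‖φ h‖ₑ := fun h => by
    change ‖starRingEnd ℂ (φ h)‖ₑ = _
    rw [← ofReal_norm, RCLike.norm_conj, ofReal_norm]
  have hχ : ∀ h, ‖χ h‖ₑ ≤ C * voiceL1Norm μ π m g₁ h := fun h => by
    rw [hnorm]
    refine (hC h).trans ?_
    gcongr
    refine lintegral_mono fun x => ?_
    gcongr
    exact leftWeight_le hm hp0 x
  set Θ : G → ℂ := fun x => χ ⟨(π x : H →L[ℂ] H) g₀, hS x⟩
  have hΘcont : Continuous Θ :=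
    continuous_functional_rep hπ hV hm hg₁₀ ENNReal.coe_ne_top hχ hS
  set Φ : G → ℂ := fun x => φ ⟨(π x : H →L[ℂ] H) g₀, hS x⟩
  have hΦΘ : Φ = fun x => starRingEnd ℂ (Θ x) := by
    ext x; exact (RCLike.conj_conj _).symm
  have hΦcont : Continuous Φ := by
    rw [hΦΘ]; exact RCLike.continuous_conj.comp hΘcont
  have hΦp := (memWiener_iff_isAmalgam hQ hm hp0 hΦcont).1 hφ
  have hΦ1 := hΦp.of_rpow hV hm hp0 hp1 hΦcont.enorm.lowerSemicontinuous
  have hΘint : Integrable Θ μ := by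
    refine ⟨hΘcont.aestronglyMeasurable, ?_⟩
    have h1 := hm.lintegral_lt_top hΦ1.lintegral_mul_lt_top
    rw [HasFiniteIntegral]
    simpa only [Θ, hnorm] using h1
  set d : ℂ := κ * inner ℂ g₀ g₀
  have hd : d ≠ 0 := mul_ne_zero (by exact_mod_cast hκ.ne_zero) (inner_self_ne_zero.2 hg₀)
  have hint : ∀ h : H, Integrable (fun x => voice π g₀ h x * Θ x) μ := fun h =>
    hΘint.bdd_mul (c := ‖g₀‖ * ‖h‖) (hπ.continuous_voice g₀ h).aestronglyMeasurable
      (.of_forall fun x => norm_voice_le g₀ h x)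
  let L₀ : H →ₗ[ℂ] ℂ :=
    { toFun := fun h => d⁻¹ * ∫ x, voice π g₀ h x * Θ x ∂μ
      map_add' := fun a b => by
        rw [← mul_add, ← integral_add (hint a) (hint b)]
        simp only [voice_add, Pi.add_apply, add_mul]
      map_smul' := fun c a => by
        simp only [voice_smul, Pi.smul_apply, smul_eq_mul, mul_assoc, integral_const_mul,
          RingHom.id_apply]
        ring }
  -- The bound uses `|V_{g₀}h| ≤ ‖g₀‖‖h‖` and the integrability of `Θ`.
  let L : H →L[ℂ] ℂ := L₀.mkContinuous (‖d⁻¹‖ * (‖g₀‖ * ∫ x, ‖Θ x‖ ∂μ)) fun h => by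
    change ‖d⁻¹ * ∫ x, voice π g₀ h x * Θ x ∂μ‖ ≤ _
    rw [norm_mul, mul_assoc]
    gcongr
    calc ‖∫ x, voice π g₀ h x * Θ x ∂μ‖ ≤ ∫ x, ‖voice π g₀ h x * Θ x‖ ∂μ :=
          norm_integral_le_integral_norm _
      _ ≤ ∫ x, (‖g₀‖ * ‖h‖) * ‖Θ x‖ ∂μ := by
          refine integral_mono (hint h).norm (hΘint.norm.const_mul _) fun x => ?_
          simp only [norm_mul]
          gcongr
          exact norm_voice_le g₀ h x
      _ = _ := by rw [integral_const_mul]; ring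
  have hLχ : ∀ h : HOne μ hπ (leftWeight μ Q p w) g₁, L h = χ h := by
    intro h
    obtain ⟨C', hC', hle⟩ := exists_le_leftWeight (μ := μ) hV hQ hm hp0
    have h1 : voiceL1Norm μ π m g₁ h < ∞ := voiceL1Norm_lt_top_of_weight_le h.2 hC' hle
    -- Membership in `H^1_v` concerns the window `g₁`; convolving with `V_{g₀}g₁` changes the window
    -- to `g₀`.
    have h2 := hκ.isAmalgam_voice_of_lintegral hπ hV hm hg₁ hg₁ h1 hg₀₁
    have h3 := hκ.integral_voice_mul_functional hπ hV hm hg₁₀ ENNReal.coe_ne_top hχ hS h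
      h2.lintegral_mul_lt_top
    change d⁻¹ * ∫ x, voice π g₀ h x * Θ x ∂μ = χ h
    rw [h3, inv_mul_cancel_left₀ hd]
  let f : H := (InnerProductSpace.toDual ℂ H).symm L
  have hf : ∀ h : HOne μ hπ (leftWeight μ Q p w) g₁, inner ℂ (h : H) f = φ h := by
    intro h
    rw [← inner_conj_symm, InnerProductSpace.toDual_symm_apply, hLχ]
    exact RCLike.conj_conj _
  refine ⟨f, ?_, LinearMap.ext hf⟩
  rcases eq_or_ne f 0 with hf0 | hf0
  · rw [hf0, hκ.mem_BSpace_iff hπ hQ hm hp0]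
    exact isAmalgam_voice_zero_right hp0 0
  · refine (hκ.mem_BSpace_of_isAmalgam hπ hV hQ hm hp0 hp1 hf0 hg₀ ?_).1
    have : voice π g₀ f = Φ := by
      ext x; exact hf ⟨_, hS x⟩
    rw [this]
    exact hΦp

end Coorbits

end Coorbit

/-! ### The theorem. -/

theorem theorem4p5 {G : Type*} [Group G] [TopologicalSpace G] [IsTopologicalGroup G]
    [LocallyCompactSpace G] [T2Space G] [MeasurableSpace G] [BorelSpace G]
    (hG : Coorbit.IsINGroup G) (μ : Measure G) [μ.IsHaarMeasure] [μ.Regular]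
    {H : Type*} [NormedAddCommGroup H] [InnerProductSpace ℂ H] [CompleteSpace H]
    (π : G →* unitary (H →L[ℂ] H)) (hπ : Coorbit.IsIrreducibleUnitaryRep π)
    (Q : Set G) (hQ : Coorbit.IsWindow Q)
    (w : G → ℝ) (hw : Coorbit.IsSubmultiplicativeWeight w) (hsymm : ∀ x, w x⁻¹ = w x)
    (p : ℝ) (hp0 : 0 < p) (hp1 : p ≤ 1)
    (f g : H) (hf : f ≠ 0) (hg : g ≠ 0)
    (hfg : Coorbit.MemWiener μ Q p (Coorbit.toWeight w) (Coorbit.voice π g f)) :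
    f ∈ Coorbit.BSpace μ π Q p w ∧ g ∈ Coorbit.BSpace μ π Q p w ∧
    (∃ g₀ ∈ Coorbit.BY μ π Q p w, g₀ ≠ 0) ∧
    ∀ g₁ ∈ Coorbit.analyzingA μ π (Coorbit.leftWeight μ Q p w), g₁ ≠ 0 →
    ∀ g₀ ∈ Coorbit.BY μ π Q p w, g₀ ≠ 0 →
    ∃ hg₀ : ∀ x : G, (π x : H →L[ℂ] H) g₀ ∈
        Coorbit.HOne μ hπ (Coorbit.leftWeight μ Q p w) g₁,
      Set.BijOn (Coorbit.toAntifunctional μ hπ (Coorbit.leftWeight μ Q p w) g₁)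
        (Coorbit.BSpace μ π Q p w) (Coorbit.CoorbitSpace μ hπ Q p w g₁ g₀ hg₀) := by
  obtain ⟨V, hV⟩ := hG.exists_isInvariantNhd
  have := hV.isMulRightInvariant μ
  have := hV.isInvInvariant μ
  have hm := hw.isSymmWeight_toWeight hsymm
  have hfg' := (Coorbit.memWiener_iff_isAmalgam hQ hm hp0 (hπ.continuous_voice g f)).1 hfg
  obtain ⟨κ, hκ⟩ :=
    Coorbit.exists_isOrthogonality_of_isAmalgam hπ hV hm hp0 hp1 hf hg hfg'
  obtain ⟨hfB, hgB⟩ := hκ.mem_BSpace_of_isAmalgam hπ hV hQ hm hp0 hp1 hf hg hfg'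
  refine ⟨hfB, hgB, ⟨g, hκ.BSpace_subset_BY hπ hV hQ hm hp0 hp1 hgB, hg⟩, ?_⟩
  intro g₁ hg₁A hg₁ g₀ hg₀Y hg₀
  have hg₀B := Coorbit.BY_subset_BSpace hV hQ hm hp0 hg₀Y
  have hg₀₀ := ((hκ.mem_BSpace_iff hπ hQ hm hp0 g₀).1 hg₀B).voice_of_rpow hπ hV hm hp0 hp1
  obtain ⟨C, hC, hCle⟩ := Coorbit.exists_le_leftWeight (μ := μ) hV hQ hm hp0
  have hg₁L : Coorbit.voiceL1Norm μ π (Coorbit.toWeight w) g₁ g₁ < ∞ :=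
    Coorbit.voiceL1Norm_lt_top_of_weight_le hg₁A hC hCle
  -- The vector `g₁` has only an integrable coefficient; convolving it with a left translate of
  -- `V_{g₀}g₀` puts `V_{g₀}g₁`, and by inversion `V_{g₁}g₀`, in the amalgam space for exponent `1`.
  have hg₀₁ := hκ.isAmalgam_voice_of_lintegral hπ hV hm hg₁ hg₀ hg₁L hg₀₀
  have hg₁₀ : Coorbit.IsAmalgam μ (Coorbit.toWeight w) fun x => ‖Coorbit.voice π g₁ g₀ x‖ₑ := by
    simp only [Coorbit.enorm_voice_swap g₀ g₁]
    exact hg₀₁.comp_inv hV hm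
  have hS : ∀ x : G, (π x : H →L[ℂ] H) g₀ ∈
      Coorbit.HOne μ hπ (Coorbit.leftWeight μ Q p w) g₁ := fun x =>
    Coorbit.voiceL1Norm_lt_top_of_weight_le (m := Coorbit.toWeight w)
      ((Coorbit.voiceL1Norm_rep_le hm g₁ g₀ x).trans_lt
        (ENNReal.mul_lt_top (hm.ne_top x).lt_top hg₁₀.lintegral_mul_lt_top))
      ENNReal.one_ne_top fun y => by rw [one_mul]; exact Coorbit.leftWeight_le hm hp0 y
  exact ⟨hS, hκ.mapsTo_toAntifunctional hπ hV hQ hm hp0 hp1 hg₁ hg₀ hg₀B hS,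
    (Coorbit.injective_toAntifunctional hπ hg₀ hS).injOn,
    hκ.surjOn_toAntifunctional hπ hV hQ hm hp0 hp1 hg₁ hg₀ hg₁₀ hg₀₁ hS⟩
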